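/- Let $m,n$ be positive integers, let $R=(r_1,\dots,r_m)\in\mathbb Z_{\ge0}^m$ and $C=(c_1,\dots,c_n)\in\mathbb Z_{\ge0}^n$ satisfy $\sum_i r_i=\sum_j c_j=N$, and let $\kappa\in\mathbb Z_{>0}\cup\{\infty\}$. For $\kappa=\infty$, read $\{0,1,\dots,\kappa\}$ as $\mathbb Z_{\ge0}$ and $[0,\kappa]$ as $[0,\infty)$. Let $\Pi_\kappa(R,C)$ be the set of real $m\times n$ matrices $Z=(z_{ij})$ with entries in $[0,\kappa]$, row sums $\sum_j z_{ij}=r_i$ and column sums $\sum_i z_{ij}=c_j$; let $T_\kappa(R,C)$ be the number of integer points of $\Pi_\kappa(R,C)$. For $s\ge 1$ let $R^{(s)}\in\mathbb Z_{\ge0}^{sm}$ be the concatenation of $s$ copies of $(sr_1,\dots,sr_m)$, and $C^{(s)}\in\mathbb Z_{\ge0}^{sn}$ the concatenation of $s$ copies of $(sc_1,\dots,sc_n)$. A distribution on $\{0,1,\dots,\kappa\}$ is called truncated geometric if there are $p\in(0,1]$ and $q\in[0,\infty)$ with $\Pr[t]=pq^t$ for all $t\in\{0,1,\dots,\kappa\}$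 (with $0^0=1$), or if $\kappa<\infty$ and it is the point mass at $\kappa$. For each $x\in[0,\kappa]$ there is exactly one truncated geometric distribution with mean $x$; let $H^{\max}_\kappa(x)=-\sum_t\Pr[t]\ln\Pr[t]$ denote its entropy (with $0\ln 0=0$). Let $\binom{n}{r}_\kappa$ be the coefficient of $x^r$ in $(1+x+x^2+\cdots+x^\kappa)^n$ (a power of the series $\sum_{t\ge0}x^t$ if $\kappa=\infty$). The independence heuristic is $$I_\kappa(R,C)=\binom{mn}{N}_\kappa^{-1}\prod_{i=1}^m\binom{n}{r_i}_\kappa\prod_{j=1}^n\binom{m}{c_j}_\kappa,$$ and $I_\kappa(R^{(s)},C^{(s)})$ is given by the same formula with $m,n,N$ replaced by $sm,sn,s^2N$. Assume that $T_\kappa(R,C)>0$. Then: (i) the maximum below is attained, the limit exists, and $$\lim_{s\to\infty}\frac1{s^2}\ln T_\kappa(R^{(s)},C^{(s)})=\max_{Z\in\Pi_\kappa(R,C)}\sum_{i=1}^m\sum_{j=1}^n H^{\max}_\kappa(z_{ij});$$ (ii) the limit below exists, and $$\lim_{s\to\infty}\frac1{s^2}\ln I_\kappa(R^{(s)},C^{(s)})=-mn\,H^{\max}_\kappa\!\left(\frac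 N{mn}\right)+n\sum_{i=1}^m H^{\max}_\kappa\!\left(\frac{r_i}n\right)+m\sum_{j=1}^n H^{\max}_\kappa\!\left(\frac{c_j}m\right).$$ -/

import Mathlib

open Filter Topology

noncomputable section

namespace CTable

/-! ### Contingency tables and the transportation polytope -/

/-- The truncated transportation polytope `Π_κ(R,C)`: the real `m × n` matrices with entries in
`[0, κ]` (in `[0, ∞)` when `κ = ⊤`), row sums `R` and column sums `C`. -/
def polytope {m n : ℕ} (κ : ℕ∞) (R : Fin m → ℕ) (C : Fin n → ℕ) :
    Set (Matrix (Fin m) (Fin n) ℝ) :=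
  {Z | (∀ i j, 0 ≤ Z i j) ∧ (∀ k : ℕ, κ = k → ∀ i j, Z i j ≤ k) ∧
    (∀ i, ∑ j, Z i j = R i) ∧ (∀ j, ∑ i, Z i j = C j)}

/-- The contingency tables with margins `R`, `C` and entries in `{0, 1, …, κ}`. -/
def tables {m n : ℕ} (κ : ℕ∞) (R : Fin m → ℕ) (C : Fin n → ℕ) :
    Set (Matrix (Fin m) (Fin n) ℕ) :=
  {A | (∀ i j, (A i j : ℕ∞) ≤ κ) ∧ (∀ i, ∑ j, A i j = R i) ∧ (∀ j, ∑ i, A i j = C j)}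

/-- Contingency tables are the integer points of the polytope. -/
theorem mem_tables_iff {m n : ℕ} (κ : ℕ∞) (R : Fin m → ℕ) (C : Fin n → ℕ)
    (A : Matrix (Fin m) (Fin n) ℕ) :
    A ∈ tables κ R C ↔ A.map (fun a : ℕ => (a : ℝ)) ∈ polytope κ R C := by
  have e : (∀ i j, (A i j : ℕ∞) ≤ κ) ↔ ∀ k : ℕ, κ = k → ∀ i j, (A i j : ℝ) ≤ k := by
    induction κ using ENat.recTopCoe with
    | top => simp
    | coe k => simp
  simp only [tables, polytope, Set.mem_ofPred_eq, Matrix.map_apply, e]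
  norm_cast
  simp

/-- There are only finitely many tables with given margins, so that counting them with
`Set.ncard` is meaningful. -/
theorem finite_tables {m n : ℕ} (κ : ℕ∞) (R : Fin m → ℕ) (C : Fin n → ℕ) :
    (tables κ R C).Finite := by
  refine (Set.Finite.pi' (fun i : Fin m => Set.Finite.pi' (fun _ : Fin n =>
    Set.finite_Iic (R i)))).subset ?_
  intro A hA i j
  rw [Set.mem_Iic, ← hA.2.1 i]
  exact Finset.single_le_sum (f := fun j => A i j) (fun _ _ => Nat.zero_le _) (Finset.mem_univ j)

/-- `T_κ(R,C)`, the number of contingency tables. -/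
def numTables {m n : ℕ} (κ : ℕ∞) (R : Fin m → ℕ) (C : Fin n → ℕ) : ℕ :=
  (tables κ R C).ncard

/-- The `s`-fold cloning of a vector: `s` consecutive copies of `(s r₁, …, s r_m)`. -/
def clone {m : ℕ} (s : ℕ) (R : Fin m → ℕ) : Fin (s * m) → ℕ :=
  fun i => s * R i.modNat

/-! ### Truncated geometric distributions and their entropy -/

/-- `μ` is truncated geometric with support `{0, 1, …, κ}`: either `Pr[t] = p q ^ t` on the support
with `p ∈ (0,1]` and `q ∈ [0,∞)`, or (`κ` finite; parameters `p = 0`, `q = ∞`) `μ` is the point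
mass at `κ`. For `κ = ⊤` the total mass being `1` forces `q < 1`. -/
def IsTruncatedGeometric (κ : ℕ∞) (μ : PMF ℕ) : Prop :=
  (∃ p q : ℝ, 0 < p ∧ p ≤ 1 ∧ 0 ≤ q ∧
      (∀ t : ℕ, (t : ℕ∞) ≤ κ → (μ t).toReal = p * q ^ t) ∧
      (∀ t : ℕ, κ < (t : ℕ∞) → μ t = 0)) ∨
    ∃ k : ℕ, κ = k ∧ μ = PMF.pure k

/-- `μ` has expected value `x`. -/
def HasMean (μ : PMF ℕ) (x : ℝ) : Prop :=
  HasSum (fun t : ℕ => (t : ℝ) * (μ t).toReal) x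

/-- Shannon entropy to base `e`: `-∑ Pr[t] ln Pr[t]`. -/
def entropy (μ : PMF ℕ) : ℝ :=
  ∑' t : ℕ, -((μ t).toReal * Real.log (μ t).toReal)

open Classical in
/-- `TG(x;κ)`: the truncated geometric distribution with support `{0, 1, …, κ}` and expected
value `x`. It exists and is unique for `x ∈ [0, κ]`; outside this domain the value is
irrelevant. -/
def TG (κ : ℕ∞) (x : ℝ) : PMF ℕ :=
  if h : ∃ μ, IsTruncatedGeometric κ μ ∧ HasMean μ x then h.choose else PMF.pure 0

theorem hasSum_toReal (μ : PMF ℕ) : HasSum (fun t => (μ t).toReal) 1 := by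
  have h := (ENNReal.summable_toReal (μ.tsum_coe ▸ ENNReal.one_ne_top)).hasSum
  rwa [← ENNReal.tsum_toReal_eq (fun t => μ.apply_ne_top t), μ.tsum_coe, ENNReal.toReal_one] at h

theorem pmf_ext_toReal {μ ν : PMF ℕ} (h : ∀ t, (μ t).toReal = (ν t).toReal) : μ = ν :=
  PMF.ext fun t => (ENNReal.toReal_eq_toReal_iff' (μ.apply_ne_top t) (ν.apply_ne_top t)).1 (h t)

/-- A distribution whose mean is an endpoint `k` of its range is the point mass at `k`. -/
theorem eq_pure_of_mean {μ : PMF ℕ} {k : ℕ} (hm : HasMean μ k)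
    (hs : (∀ t, μ t ≠ 0 → t ≤ k) ∨ k = 0) : μ = PMF.pure k := by
  have h1 := hm.sub ((hasSum_toReal μ).mul_left (k : ℝ))
  simp only [mul_one, sub_self] at h1
  have key : ∀ t, t ≠ k → μ t = 0 := by
    rcases hs with hs | rfl
    · have h2 := (hasSum_zero_iff_of_nonneg (f := fun t : ℕ => -((t : ℝ) * (μ t).toReal
        - k * (μ t).toReal)) (fun t => ?_)).1 (by simpa using h1.neg)
      · intro t ht
        have h3 := congrFun h2 t
        by_contra h0
        have h4 : (t : ℝ) ≠ k := by exact_mod_cast ht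
        have h5 : (μ t).toReal ≠ 0 := (ENNReal.toReal_pos h0 (μ.apply_ne_top t)).ne'
        have h6 : ((k : ℝ) - t) * (μ t).toReal = 0 := by
          simp only [Pi.zero_apply] at h3; linarith
        rcases mul_eq_zero.1 h6 with h | h
        · exact h4 (by linarith)
        · exact h5 h
      · by_cases h0 : μ t = 0
        · simp [h0]
        · have : (t : ℝ) ≤ k := by exact_mod_cast hs t h0
          have := mul_nonneg (sub_nonneg.2 this) (ENNReal.toReal_nonneg (a := μ t))
          change (0 : ℝ) ≤ _
          linarith
    · have h2 := (hasSum_zero_iff_of_nonneg (f := fun t : ℕ => (t : ℝ) * (μ t).toReal)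
        (fun t => by positivity)).1 (by simpa using h1)
      intro t ht
      have h3 := congrFun h2 t
      simp only [Pi.zero_apply, mul_eq_zero, Nat.cast_eq_zero, ht, false_or] at h3
      exact (ENNReal.toReal_eq_zero_iff _).1 h3 |>.resolve_right (μ.apply_ne_top t)
  refine PMF.ext fun t => ?_
  have hk : μ k = 1 := by rw [← μ.tsum_coe, tsum_eq_single k key]
  by_cases h : t = k
  · subst h; simp [hk]
  · simp [key t h, h]

theorem IsTruncatedGeometric.le_of_ne_zero {κ : ℕ∞} {μ : PMF ℕ} (h : IsTruncatedGeometric κ μ)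
    (t : ℕ) (ht : μ t ≠ 0) : (t : ℕ∞) ≤ κ := by
  rcases h with ⟨p, q, -, -, -, -, h⟩ | ⟨k, rfl, rfl⟩
  · by_contra hc
    exact ht (h t (not_le.1 hc))
  · simp at ht
    simp [ht]

/-- Uniqueness of the truncated geometric distribution with given support and mean. -/
theorem IsTruncatedGeometric.unique {κ : ℕ∞} {μ ν : PMF ℕ} {x : ℝ}
    (hμ : IsTruncatedGeometric κ μ) (hν : IsTruncatedGeometric κ ν)
    (mμ : HasMean μ x) (mν : HasMean ν x) : μ = ν := by
  -- the point mass at `κ`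
  have top : ∀ {μ ν : PMF ℕ}, IsTruncatedGeometric κ ν → HasMean μ x → HasMean ν x →
      (∃ k : ℕ, κ = k ∧ μ = PMF.pure k) → μ = ν := by
    rintro μ ν hν mμ mν ⟨k, rfl, rfl⟩
    have hx : x = k := by
      refine mμ.unique ?_
      convert hasSum_single (f := fun t : ℕ => (t : ℝ) * ((PMF.pure k : PMF ℕ) t).toReal) k ?_
        using 1
      · simp
      · intro t ht; simp [ht]
    subst hx
    exact (eq_pure_of_mean mν (Or.inl fun t ht => by exact_mod_cast hν.le_of_ne_zero t ht)).symm
  -- the point mass at `0`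
  have zero : ∀ {μ ν : PMF ℕ} {p : ℝ}, HasMean μ x → HasMean ν x →
      (∀ t : ℕ, (t : ℕ∞) ≤ κ → (μ t).toReal = p * 0 ^ t) →
      (∀ t : ℕ, κ < (t : ℕ∞) → μ t = 0) → μ = ν := by
    intro μ ν p mμ mν h1 h2
    have h3 : ∀ t : ℕ, (t : ℝ) * (μ t).toReal = 0 := by
      intro t
      rcases le_or_gt (t : ℕ∞) κ with h | h
      · rw [h1 t h]; cases t <;> simp
      · simp [h2 t h]
    have hx : x = ((0 : ℕ) : ℝ) := by
      refine mμ.unique ?_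
      simp only [h3]
      simp
    subst hx
    rw [eq_pure_of_mean mμ (Or.inr rfl), eq_pure_of_mean mν (Or.inr rfl)]
  rcases hμ with ⟨p, q, hp, hp1, hq, h1, h2⟩ | hμ
  swap
  · exact top hν mμ mν hμ
  rcases hν with ⟨p', q', hp', hp1', hq', h1', h2'⟩ | hν
  swap
  · exact (top (Or.inl ⟨p, q, hp, hp1, hq, h1, h2⟩) mν mμ hν).symm
  rcases hq.eq_or_lt with rfl | hq
  · exact zero mμ mν h1 h2
  rcases hq'.eq_or_lt with rfl | hq'
  · exact (zero mν mμ h1' h2').symm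
  -- both have full support: `∑ (μ t - ν t) (ln μ t - ln ν t) = 0` has nonnegative terms
  have hs := (((hasSum_toReal μ).sub (hasSum_toReal ν)).mul_left (Real.log p - Real.log p')).add
    ((mμ.sub mν).mul_left (Real.log q - Real.log q'))
  simp only [sub_self, mul_zero, add_zero] at hs
  have ht : ∀ t : ℕ, (t : ℕ∞) ≤ κ →
      (Real.log p - Real.log p') * ((μ t).toReal - (ν t).toReal) +
        (Real.log q - Real.log q') * (t * (μ t).toReal - t * (ν t).toReal) =
      (Real.log (μ t).toReal - Real.log (ν t).toReal) * ((μ t).toReal - (ν t).toReal) := by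
    intro t h
    have e1 : Real.log (μ t).toReal = Real.log p + t * Real.log q := by
      rw [h1 t h, Real.log_mul hp.ne' (pow_pos hq t).ne', Real.log_pow]
    have e2 : Real.log (ν t).toReal = Real.log p' + t * Real.log q' := by
      rw [h1' t h, Real.log_mul hp'.ne' (pow_pos hq' t).ne', Real.log_pow]
    rw [e1, e2]; ring
  have hz := (hasSum_zero_iff_of_nonneg (fun t => by
    change (0 : ℝ) ≤ _
    rcases le_or_gt (t : ℕ∞) κ with h | h
    · rw [ht t h]
      have a1 : 0 < (μ t).toReal := by rw [h1 t h]; positivity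
      have a2 : 0 < (ν t).toReal := by rw [h1' t h]; positivity
      rcases le_total (μ t).toReal (ν t).toReal with hle | hle
      · exact mul_nonneg_of_nonpos_of_nonpos (sub_nonpos.2 (Real.log_le_log a1 hle))
          (sub_nonpos.2 hle)
      · exact mul_nonneg (sub_nonneg.2 (Real.log_le_log a2 hle)) (sub_nonneg.2 hle)
    · simp [h2 t h, h2' t h])).1 hs
  refine pmf_ext_toReal fun t => ?_
  rcases le_or_gt (t : ℕ∞) κ with h | h
  · have h3 := congrFun hz t
    simp only [Pi.zero_apply] at h3
    rw [ht t h] at h3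
    have a1 : 0 < (μ t).toReal := by rw [h1 t h]; positivity
    have a2 : 0 < (ν t).toReal := by rw [h1' t h]; positivity
    rcases mul_eq_zero.1 h3 with h4 | h4
    · exact Real.log_injOn_pos a1 a2 (by linarith)
    · linarith
  · simp [h2 t h, h2' t h]

/-- Existence of the truncated geometric distribution with given support and mean. -/
theorem exists_isTruncatedGeometric (κ : ℕ∞) {x : ℝ} (hx0 : 0 ≤ x)
    (hx : ∀ k : ℕ, κ = k → x ≤ k) : ∃ μ, IsTruncatedGeometric κ μ ∧ HasMean μ x := by
  induction κ using ENat.recTopCoe with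
  | top =>
    have hq0 : 0 ≤ x / (1 + x) := by positivity
    have hq1 : x / (1 + x) < 1 := by rw [div_lt_one (by positivity)]; linarith
    have h1x : (1 + x) ≠ 0 := by positivity
    have he : 1 - x / (1 + x) = 1 / (1 + x) := by field_simp; ring
    have hs : HasSum (fun t : ℕ => 1 / (1 + x) * (x / (1 + x)) ^ t) 1 := by
      have h := (hasSum_geometric_of_lt_one hq0 hq1).mul_left (1 / (1 + x))
      have e : 1 / (1 + x) * (1 - x / (1 + x))⁻¹ = 1 := by
        rw [he]; field_simp
      rwa [e] at h
    have hs' : HasSum (fun t : ℕ => ENNReal.ofReal (1 / (1 + x) * (x / (1 + x)) ^ t)) 1 := by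
      rw [ENNReal.summable.hasSum_iff, ← ENNReal.ofReal_tsum_of_nonneg
        (fun t => by positivity) hs.summable, hs.tsum_eq, ENNReal.ofReal_one]
    have hv : ∀ t : ℕ, (ENNReal.ofReal (1 / (1 + x) * (x / (1 + x)) ^ t)).toReal =
        1 / (1 + x) * (x / (1 + x)) ^ t := fun t => ENNReal.toReal_ofReal (by positivity)
    refine ⟨⟨_, hs'⟩, Or.inl ⟨1 / (1 + x), x / (1 + x), by positivity, ?_, hq0,
      fun t _ => hv t, by simp⟩, ?_⟩
    · rw [div_le_one (by positivity)]; linarith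
    · change HasSum (fun t : ℕ => (t : ℝ) *
        (ENNReal.ofReal (1 / (1 + x) * (x / (1 + x)) ^ t)).toReal) x
      simp only [hv]
      have h := (hasSum_coe_mul_geometric_of_norm_lt_one (r := x / (1 + x))
        (by rwa [Real.norm_of_nonneg hq0])).mul_left (1 / (1 + x))
      have e : 1 / (1 + x) * (x / (1 + x) / (1 - x / (1 + x)) ^ 2) = x := by
        rw [he]; field_simp
      rw [e] at h
      exact h.congr_fun fun t => by ring
  | coe k =>
    have hxk := hx k rfl
    rcases hxk.eq_or_lt with rfl | hxk
    · refine ⟨PMF.pure k, Or.inr ⟨k, rfl, rfl⟩, ?_⟩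
      unfold HasMean
      convert hasSum_single (f := fun t : ℕ => (t : ℝ) * ((PMF.pure k : PMF ℕ) t).toReal) k ?_
        using 1
      · simp
      · intro t ht; simp [ht]
    -- a root of `∑ (t - x) q ^ t`
    obtain ⟨q, hq, hroot⟩ : ∃ q : ℝ, 0 ≤ q ∧
        ∑ t ∈ Finset.range (k + 1), ((t : ℝ) - x) * q ^ t = 0 := by
      have hc : Continuous fun q : ℝ => ∑ t ∈ Finset.range (k + 1), ((t : ℝ) - x) * q ^ t := by
        fun_prop
      obtain ⟨Q, hQ1, hQ⟩ : ∃ Q : ℝ, 1 ≤ Q ∧ x * k ≤ (k - x) * Q := by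
        refine ⟨max 1 (x * k / (k - x)), le_max_left _ _, ?_⟩
        have h := sub_pos.2 hxk
        calc x * k = (k - x) * (x * k / (k - x)) := by field_simp
          _ ≤ _ := mul_le_mul_of_nonneg_left (le_max_right _ _) h.le
      have hQ0 : (0 : ℝ) ≤ Q := by linarith
      have h0 : ∑ t ∈ Finset.range (k + 1), ((t : ℝ) - x) * (0 : ℝ) ^ t ≤ 0 := by
        rw [Finset.sum_range_succ']
        simp [hx0]
      have hpos : 0 ≤ ∑ t ∈ Finset.range (k + 1), ((t : ℝ) - x) * Q ^ t := by
        rw [Finset.sum_range_succ]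
        cases k with
        | zero => simp at hxk; linarith
        | succ k =>
          have : ∑ t ∈ Finset.range (k + 1), (-x) * Q ^ k ≤
              ∑ t ∈ Finset.range (k + 1), ((t : ℝ) - x) * Q ^ t := by
            refine Finset.sum_le_sum fun t ht => ?_
            have h1 : Q ^ t ≤ Q ^ k :=
              pow_le_pow_right₀ hQ1 (Nat.lt_succ_iff.1 (Finset.mem_range.1 ht))
            have h2 : (0 : ℝ) ≤ t * Q ^ t := by positivity
            nlinarith [mul_le_mul_of_nonneg_left h1 hx0]
          rw [Finset.sum_const, Finset.card_range, nsmul_eq_mul] at this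
          have h3 := mul_le_mul_of_nonneg_right hQ (pow_nonneg hQ0 k)
          rw [pow_succ Q k]
          nlinarith
      obtain ⟨q, hq, h⟩ := intermediate_value_Icc hQ0 hc.continuousOn ⟨h0, hpos⟩
      exact ⟨q, hq.1, h⟩
    set S : ℝ := ∑ t ∈ Finset.range (k + 1), q ^ t with hS
    have hS1 : 1 ≤ S := by
      rw [hS, Finset.sum_range_succ']
      have : 0 ≤ ∑ t ∈ Finset.range k, q ^ (t + 1) := Finset.sum_nonneg fun t _ => by positivity
      simpa using this
    have hS0 : 0 < S := by linarith
    let f : ℕ → ℝ := fun t => if t ∈ Finset.range (k + 1) then S⁻¹ * q ^ t else 0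
    have hf0 : ∀ t, 0 ≤ f t := fun t => by
      simp only [f]; split_ifs <;> positivity
    have hf : HasSum f 1 := by
      have h : HasSum f (∑ t ∈ Finset.range (k + 1), f t) :=
        hasSum_sum_of_ne_finset_zero (fun t ht => by simp only [f, if_neg ht])
      have e : ∑ t ∈ Finset.range (k + 1), f t = 1 := by
        rw [Finset.sum_congr rfl (fun t ht => by simp only [f, if_pos ht] :
          ∀ t ∈ Finset.range (k + 1), f t = S⁻¹ * q ^ t), ← Finset.mul_sum, ← hS]
        exact inv_mul_cancel₀ hS0.ne'
      rwa [e] at h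
    have hs' : HasSum (fun t : ℕ => ENNReal.ofReal (f t)) 1 := by
      rw [ENNReal.summable.hasSum_iff, ← ENNReal.ofReal_tsum_of_nonneg hf0 hf.summable,
        hf.tsum_eq, ENNReal.ofReal_one]
    have hv : ∀ t : ℕ, (ENNReal.ofReal (f t)).toReal = f t :=
      fun t => ENNReal.toReal_ofReal (hf0 t)
    refine ⟨⟨_, hs'⟩, Or.inl ⟨S⁻¹, q, by positivity, inv_le_one_of_one_le₀ hS1, hq, ?_, ?_⟩, ?_⟩
    · intro t ht
      have ht' : t ∈ Finset.range (k + 1) :=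
        Finset.mem_range.2 (Nat.lt_succ_iff.2 (by exact_mod_cast ht))
      refine (hv t).trans ?_
      simp only [f, if_pos ht']
    · intro t ht
      have ht' : t ∉ Finset.range (k + 1) := by
        have : k < t := by exact_mod_cast ht
        simp; omega
      change ENNReal.ofReal (f t) = 0
      simp only [f, if_neg ht', ENNReal.ofReal_zero]
    · change HasSum (fun t : ℕ => (t : ℝ) * (ENNReal.ofReal (f t)).toReal) x
      simp only [hv]
      have h : HasSum (fun t : ℕ => (t : ℝ) * f t) (∑ t ∈ Finset.range (k + 1), (t : ℝ) * f t) :=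
        hasSum_sum_of_ne_finset_zero (fun t ht => by simp only [f, if_neg ht, mul_zero])
      have e : ∑ t ∈ Finset.range (k + 1), (t : ℝ) * f t = x := by
        have e1 : ∀ t ∈ Finset.range (k + 1),
            (t : ℝ) * f t = S⁻¹ * (((t : ℝ) - x) * q ^ t) + S⁻¹ * x * q ^ t := by
          intro t ht; simp only [f, if_pos ht]; ring
        rw [Finset.sum_congr rfl e1, Finset.sum_add_distrib, ← Finset.mul_sum, hroot,
          ← Finset.mul_sum, ← hS]
        field_simp; ring
      rwa [e] at h

/-- `TG(x;κ)` is the truncated geometric distribution with support `{0, 1, …, κ}` and mean `x`. -/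
theorem eq_TG_iff (κ : ℕ∞) {x : ℝ} (hx0 : 0 ≤ x) (hx : ∀ k : ℕ, κ = k → x ≤ k) (μ : PMF ℕ) :
    μ = TG κ x ↔ IsTruncatedGeometric κ μ ∧ HasMean μ x := by
  have h := exists_isTruncatedGeometric κ hx0 hx
  have hTG : TG κ x = h.choose := by rw [TG, dif_pos h]
  rw [hTG]
  refine ⟨?_, fun hμ => hμ.1.unique h.choose_spec.1 hμ.2 h.choose_spec.2⟩
  rintro rfl
  exact h.choose_spec

/-- `H^max_κ(x)`, the entropy of `TG(x;κ)`. -/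
def Hmax (κ : ℕ∞) (x : ℝ) : ℝ := entropy (TG κ x)

/-! ### The independence heuristic -/

open Classical in
/-- The `(κ+1)`-nomial coefficient: the coefficient of `x ^ r` in `(1 + x + ⋯ + x ^ κ) ^ n`. -/
def nomial (κ : ℕ∞) (n r : ℕ) : ℕ :=
  PowerSeries.coeff r ((PowerSeries.mk fun t : ℕ => if (t : ℕ∞) ≤ κ then (1 : ℕ) else 0) ^ n)

/-- The independence heuristic `I_κ(R,C)`, where `N` is the sum of the entries of `R`. -/
def indepHeuristic {m n : ℕ} (κ : ℕ∞) (R : Fin m → ℕ) (C : Fin n → ℕ) : ℝ :=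
  ((nomial κ (m * n) (∑ i, R i) : ℝ))⁻¹ *
    (∏ i, (nomial κ n (R i) : ℝ)) * ∏ j, (nomial κ m (C j) : ℝ)

end CTable

end

/-! Upper bound in (i): average all cloned tables, and all `s ^ 2` copies of each position, to a
matrix `Z` in the polytope. Under independent truncated geometric entries with means `Z`, the
log-probability of a table is affine in its entries, so its average over the tables is `-s ^ 2 * ∑
Hmax (Z i j)`. By Jensen the total probability of the tables is at least their number times the
exponential of this average. As it is at most 1, the entropy bound follows, with no error term
(`log_card_le`, `exists_log_numTables_clone_le`).

Lower bound: continuity of the entropy and density of rational points of the polytope reduce the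
maximiser to a rational matrix `W`. Choose integer matrices `K s` with margins `s R`, `s C` and `K s
/ s → W`, and assemble a cloned table from independent `s × s` blocks, block `(i, j)` having all
margins `K s i j` (`prod_numTables_le`). Matrices with all row sums `c` number `nomial κ s c ^ s`,
have at most `(s c + 1) ^ s` column-sum vectors, and constant column sums are the most frequent
(`numTables_le_const'`). Hence a block has about `nomial κ s c ^ s` fillings, up to `exp (O(s log
s))`.

Two further ingredients are needed. Constant column sums win because moving a unit from a larger to
a smaller column is an injection on tables; this comes from unimodality of the coordinate sum over a
box, which also makes nomial coefficients log-concave. Log-concavity in turn shows that a tilted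
nomial distribution with integer mean `k` has at least inverse polynomial mass at `k`, so `log
(nomial κ n k) / n` tends to the entropy of the limit of `k / n` (`tendsto_log_nomial`). Part (ii)
is this asymptotic applied to each factor of the heuristic. -/

namespace CTable

/-! ### Entropy of truncated geometric distributions: formulas, concavity, continuity -/

/-- The possible means of a distribution on `{0, 1, …, κ}`. -/
def meanRange (κ : ℕ∞) : Set ℝ := {x | 0 ≤ x ∧ ∀ k : ℕ, κ = k → x ≤ k}

theorem meanRange_coe (k : ℕ) : meanRange k = Set.Icc 0 (k : ℝ) := by
  ext x
  simp only [meanRange, Set.mem_ofPred_eq, Set.mem_Icc, Nat.cast_inj]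
  exact ⟨fun h => ⟨h.1, h.2 k rfl⟩, fun h => ⟨h.1, fun _ e => e ▸ h.2⟩⟩

theorem meanRange_top : meanRange ⊤ = Set.Ici 0 := by
  ext x
  simp [meanRange]

theorem TG_spec {κ : ℕ∞} {x : ℝ} (hx : x ∈ meanRange κ) :
    IsTruncatedGeometric κ (TG κ x) ∧ HasMean (TG κ x) x :=
  (eq_TG_iff κ hx.1 hx.2 _).1 rfl

theorem TG_zero (κ : ℕ∞) : TG κ 0 = PMF.pure 0 :=
  eq_pure_of_mean (k := 0) (by simpa using (TG_spec (κ := κ) (x := 0) ⟨le_rfl, by simp⟩).2)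
    (Or.inr rfl)

theorem TG_self (k : ℕ) : TG k k = PMF.pure k := by
  have h := TG_spec (κ := k) (x := k) (by simp [meanRange_coe])
  exact eq_pure_of_mean h.2 (Or.inl fun t ht => by exact_mod_cast h.1.le_of_ne_zero t ht)

theorem entropy_pure (k : ℕ) : entropy (PMF.pure k) = 0 := by
  unfold entropy
  convert tsum_zero with t
  by_cases h : t = k <;> simp [h]

theorem Hmax_zero (κ : ℕ∞) : Hmax κ 0 = 0 := by rw [Hmax, TG_zero, entropy_pure]

theorem Hmax_self (k : ℕ) : Hmax k k = 0 := by rw [Hmax, TG_self, entropy_pure]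

theorem entropy_nonneg (μ : PMF ℕ) : 0 ≤ entropy μ := by
  refine tsum_nonneg fun t => neg_nonneg.2 (mul_nonpos_of_nonneg_of_nonpos
    ENNReal.toReal_nonneg (Real.log_nonpos ENNReal.toReal_nonneg ?_))
  exact ENNReal.toReal_mono ENNReal.one_ne_top (μ.coe_le_one t)

theorem Hmax_nonneg (κ : ℕ∞) (x : ℝ) : 0 ≤ Hmax κ x := entropy_nonneg _

/-- The truncated geometric distribution whose mean is not an endpoint has full support. -/
theorem exists_TG_eq {κ : ℕ∞} {x : ℝ} (h0 : 0 < x) (hk : ∀ k : ℕ, κ = k → x < k) :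
    ∃ p q : ℝ, 0 < p ∧ 0 < q ∧ (∀ t : ℕ, (t : ℕ∞) ≤ κ → (TG κ x t).toReal = p * q ^ t) ∧
      (∀ t : ℕ, κ < (t : ℕ∞) → (TG κ x t).toReal = 0) ∧
      Hmax κ x = -(Real.log p + x * Real.log q) := by
  have h := TG_spec (κ := κ) (x := x) ⟨h0.le, fun k e => (hk k e).le⟩
  rcases h with ⟨⟨p, q, hp, -, hq, h1, h2⟩ | ⟨k, rfl, h1⟩, hm⟩
  · have h2' : ∀ t : ℕ, κ < (t : ℕ∞) → (TG κ x t).toReal = 0 := fun t ht => by simp [h2 t ht]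
    rcases hq.eq_or_lt with rfl | hq
    · exfalso
      refine h0.ne (HasSum.unique ?_ hm)
      convert hasSum_zero with t
      rcases le_or_gt (t : ℕ∞) κ with ht | ht
      · rw [h1 t ht]
        cases t <;> simp
      · simp [h2' t ht]
    · refine ⟨p, q, hp, hq, h1, h2', ?_⟩
      -- On the support the log-probability is `log p + t * log q`, so the entropy series is a
      -- combination of total mass and mean.
      have hs := (((hasSum_toReal (TG κ x)).mul_left (Real.log p)).add
        (hm.mul_left (Real.log q))).neg
      rw [Hmax, entropy, (hs.congr_fun fun t => ?_).tsum_eq]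
      · ring
      · rcases le_or_gt (t : ℕ∞) κ with ht | ht
        · rw [h1 t ht, Real.log_mul hp.ne' (pow_pos hq t).ne', Real.log_pow]
          ring
        · simp [h2' t ht]
  · exfalso
    rw [h1] at hm
    refine (hk k rfl).ne (hm.unique ?_)
    convert hasSum_single (f := fun t : ℕ => (t : ℝ) * ((PMF.pure k : PMF ℕ) t).toReal) k ?_
      using 1
    · simp
    · intro t ht; simp [ht]

/-- The logarithm of the truncated geometric distribution is affine. -/
theorem exists_TG_eq_exp {κ : ℕ∞} {x : ℝ} (hx : x ∈ meanRange κ) :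
    ∃ α β : ℝ, Hmax κ x = -(α + β * x) ∧ ∀ t : ℕ, (t : ℕ∞) ≤ κ → (x = 0 → t = 0) →
      (∀ k : ℕ, κ = k → x = k → t = k) → (TG κ x t).toReal = Real.exp (α + β * t) := by
  rcases hx.1.eq_or_lt with rfl | h0
  -- For a point mass only the atom itself is tested, where the probability is `1 = exp 0`.
  · refine ⟨0, 0, by simp [Hmax_zero], fun t _ ht _ => ?_⟩
    simp [ht rfl, TG_zero]
  by_cases hk : ∀ k : ℕ, κ = k → x < k
  · obtain ⟨p, q, hp, hq, h1, -, h3⟩ := exists_TG_eq h0 hk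
    refine ⟨Real.log p, Real.log q, by rw [h3]; ring, fun t ht _ _ => ?_⟩
    rw [h1 t ht, Real.exp_add, Real.exp_log hp, mul_comm (Real.log q), Real.exp_nat_mul,
      Real.exp_log hq]
  · push Not at hk
    obtain ⟨k, rfl, hk⟩ := hk
    obtain rfl : x = k := le_antisymm (hx.2 k rfl) hk
    refine ⟨0, 0, by simp [Hmax_self], fun t _ _ ht => ?_⟩
    simp [ht k rfl rfl, TG_self]

/-- Total mass and mean of a geometric series force `q = x / (1 + x)` and `p = 1 / (1 + x)`. -/
theorem Hmax_top {x : ℝ} (hx : 0 ≤ x) :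
    Hmax ⊤ x = (1 + x) * Real.log (1 + x) - x * Real.log x := by
  rcases hx.eq_or_lt with rfl | h0
  · simp [Hmax_zero]
  obtain ⟨p, q, hp, hq, h1, -, h3⟩ := exists_TG_eq (κ := ⊤) h0 (by simp)
  have h := TG_spec (κ := ⊤) (x := x) (by simpa [meanRange_top] using hx)
  have hs := hasSum_toReal (TG ⊤ x)
  have hm := h.2
  unfold HasMean at hm
  simp only [h1 _ le_top] at hs hm
  have hq1 : q < 1 := by
    have := (summable_mul_left_iff hp.ne').1 hs.summable
    rw [summable_geometric_iff_norm_lt_one, Real.norm_of_nonneg hq.le] at this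
    exact this
  have e1 := hs.unique ((hasSum_geometric_of_lt_one hq.le hq1).mul_left p)
  have e2 := hm.unique (((hasSum_coe_mul_geometric_of_norm_lt_one (r := q)
    (by rwa [Real.norm_of_nonneg hq.le])).mul_left p).congr_fun fun t => by ring)
  have hq1' : (1 - q) ≠ 0 := by linarith
  have hpq : p = 1 - q := by field_simp at e1; linarith
  have hx1 : x * (1 - q) = q := by rw [e2, hpq]; field_simp
  have e3 : q = x / (1 + x) := by field_simp; linarith
  have e4 : p = 1 / (1 + x) := by rw [hpq, e3]; field_simp; ring
  rw [h3, e3, e4, Real.log_div h0.ne' (by positivity), one_div, Real.log_inv]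
  ring

theorem TG_coe_sums {k : ℕ} {x : ℝ} (hx : x ∈ Set.Icc (0 : ℝ) k) :
    ∑ t ∈ Finset.range (k + 1), (TG k x t).toReal = 1 ∧
      ∑ t ∈ Finset.range (k + 1), (t : ℝ) * (TG k x t).toReal = x := by
  have h := TG_spec (κ := k) (x := x) (by rwa [meanRange_coe])
  have h0 : ∀ t ∉ Finset.range (k + 1), (TG k x t).toReal = 0 := by
    intro t ht
    by_contra hc
    refine ht (Finset.mem_range.2 (Nat.lt_succ_iff.2 ?_))
    exact_mod_cast h.1.le_of_ne_zero t fun e => hc (by simp [e])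
  exact ⟨(hasSum_sum_of_ne_finset_zero h0).unique (hasSum_toReal _),
    (hasSum_sum_of_ne_finset_zero fun t ht => by rw [h0 t ht, mul_zero]).unique h.2⟩

/-- Gibbs' inequality for truncated geometric distributions. -/
theorem Hmax_le {k : ℕ} {x q : ℝ} (hx : x ∈ Set.Icc (0 : ℝ) k) (hq : 0 < q) :
    Hmax k x ≤ Real.log (∑ t ∈ Finset.range (k + 1), q ^ t) - x * Real.log q := by
  set S := ∑ t ∈ Finset.range (k + 1), q ^ t with hS
  have hle : ∀ t ≤ k, q ^ t ≤ S := fun t ht =>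
    Finset.single_le_sum (f := fun t => q ^ t) (fun _ _ => by positivity)
      (Finset.mem_range.2 (by omega))
  -- At the two endpoints the entropy is 0, and the single term `q ^ 0` or `q ^ k` of `S` already
  -- gives the bound.
  have hend : ∀ t ≤ k, (t : ℝ) * Real.log q ≤ Real.log S := fun t ht => by
    rw [← Real.log_pow]
    exact Real.log_le_log (by positivity) (hle t ht)
  rcases hx.1.eq_or_lt with rfl | h0
  · rw [Hmax_zero]
    simpa using hend 0 (Nat.zero_le _)
  rcases hx.2.eq_or_lt with rfl | h1
  · rw [Hmax_self]
    exact sub_nonneg.2 (hend k le_rfl)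
  have hS0 : 0 < S := lt_of_lt_of_le one_pos (by simpa using hle 0 (Nat.zero_le _))
  obtain ⟨p, r, hp, hr, hw, -, hH⟩ := exists_TG_eq (κ := k) h0
    (fun j e => by rwa [← ENat.natCast_inj.1 e])
  obtain ⟨s1, s2⟩ := TG_coe_sums hx
  -- Comparison with the law `q ^ t / S`: this is `log y ≤ y - 1` for the ratio of the two
  -- probabilities, weighted by `TG k x t`.
  have hterm : ∀ t ∈ Finset.range (k + 1), (TG k x t).toReal *
      ((Real.log q - Real.log r) * t + (-Real.log S - Real.log p)) ≤
        q ^ t / S - (TG k x t).toReal := by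
    intro t ht
    have hwt := hw t (by exact_mod_cast Nat.lt_succ_iff.1 (Finset.mem_range.1 ht))
    have hpos : 0 < (TG k x t).toReal := by rw [hwt]; positivity
    have hl := Real.log_le_sub_one_of_pos (x := q ^ t / S / (p * r ^ t)) (by positivity)
    rw [Real.log_div (by positivity) (by positivity), Real.log_div (by positivity) hS0.ne',
      Real.log_mul hp.ne' (by positivity), Real.log_pow, Real.log_pow] at hl
    have := mul_le_mul_of_nonneg_left hl hpos.le
    have e : (TG k x t).toReal * (q ^ t / S / (p * r ^ t) - 1) =
        q ^ t / S - (TG k x t).toReal := by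
      rw [← hwt]; field_simp
    rw [e] at this
    refine le_trans (le_of_eq ?_) this
    ring
  have hsum := Finset.sum_le_sum hterm
  rw [Finset.sum_sub_distrib, ← Finset.sum_div, ← hS, s1, div_self hS0.ne'] at hsum
  have e : ∑ t ∈ Finset.range (k + 1), (TG k x t).toReal *
      ((Real.log q - Real.log r) * t + (-Real.log S - Real.log p)) =
      (Real.log q - Real.log r) * x + (-Real.log S - Real.log p) := by
    calc _ = (Real.log q - Real.log r) *
          ∑ t ∈ Finset.range (k + 1), (t : ℝ) * (TG k x t).toReal +
        (-Real.log S - Real.log p) * ∑ t ∈ Finset.range (k + 1), (TG k x t).toReal := by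
          rw [Finset.mul_sum, Finset.mul_sum, ← Finset.sum_add_distrib]
          exact Finset.sum_congr rfl fun t _ => by ring
      _ = _ := by rw [s1, s2, mul_one]
  rw [e] at hsum
  rw [hH]
  linarith

/-- The equality case of Gibbs' inequality: the parameter `q` of `TG k x` itself, with `p` the
inverse of the sum. The mean equation is kept because the tilting argument for nomial coefficients
needs it. -/
theorem Hmax_eq {k : ℕ} {x : ℝ} (hx : x ∈ Set.Ioo (0 : ℝ) k) :
    ∃ q : ℝ, 0 < q ∧ ∑ t ∈ Finset.range (k + 1), ((t : ℝ) - x) * q ^ t = 0 ∧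
      Hmax k x = Real.log (∑ t ∈ Finset.range (k + 1), q ^ t) - x * Real.log q := by
  obtain ⟨p, q, hp, hq, hw, -, hH⟩ := exists_TG_eq (κ := k) hx.1
    (fun j e => by rw [← ENat.natCast_inj.1 e]; exact hx.2)
  obtain ⟨s1, s2⟩ := TG_coe_sums ⟨hx.1.le, hx.2.le⟩
  have hw' : ∀ t ∈ Finset.range (k + 1), (TG k x t).toReal = p * q ^ t := fun t ht =>
    hw t (by exact_mod_cast Nat.lt_succ_iff.1 (Finset.mem_range.1 ht))
  rw [Finset.sum_congr rfl hw', ← Finset.mul_sum] at s1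
  rw [Finset.sum_congr rfl fun t ht => by rw [hw' t ht]] at s2
  refine ⟨q, hq, ?_, ?_⟩
  · have : p * ∑ t ∈ Finset.range (k + 1), ((t : ℝ) - x) * q ^ t = 0 := by
      calc _ = ∑ t ∈ Finset.range (k + 1), (t : ℝ) * (p * q ^ t) -
            x * (p * ∑ t ∈ Finset.range (k + 1), q ^ t) := by
            rw [Finset.mul_sum, Finset.mul_sum, Finset.mul_sum, ← Finset.sum_sub_distrib]
            exact Finset.sum_congr rfl fun t _ => by ring
        _ = 0 := by rw [s1, s2]; ring
    exact (mul_eq_zero.1 this).resolve_left hp.ne'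
  · rw [hH, eq_inv_of_mul_eq_one_left s1, Real.log_inv]
    ring

/-- By `Hmax_le` and `Hmax_eq` the entropy is a minimum, over `q > 0`, of affine functions of the
mean. -/
theorem concaveOn_Hmax (k : ℕ) : ConcaveOn ℝ (Set.Ioo (0 : ℝ) k) (Hmax k) := by
  refine ⟨convex_Ioo _ _, fun x hx y hy a b ha hb hab => ?_⟩
  obtain ⟨q, hq, -, e⟩ := Hmax_eq ((convex_Ioo (0 : ℝ) k) hx hy ha hb hab)
  have h1 := mul_le_mul_of_nonneg_left (Hmax_le ⟨hx.1.le, hx.2.le⟩ hq) ha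
  have h2 := mul_le_mul_of_nonneg_left (Hmax_le ⟨hy.1.le, hy.2.le⟩ hq) hb
  rw [e]
  simp only [smul_eq_mul] at *
  calc _ ≤ _ := add_le_add h1 h2
    _ = (a + b) * Real.log (∑ t ∈ Finset.range (k + 1), q ^ t) -
        (a * x + b * y) * Real.log q := by ring
    _ = _ := by rw [hab, one_mul]

/-- For finite `κ`, concavity gives continuity in the interior; at an endpoint the entropy is
squeezed between 0 and a function vanishing there. For `κ = ⊤` the closed formula is continuous. -/
theorem continuousOn_Hmax (κ : ℕ∞) : ContinuousOn (Hmax κ) (meanRange κ) := by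
  induction κ using ENat.recTopCoe with
  | top =>
    rw [meanRange_top]
    refine ContinuousOn.congr (f := fun x => (1 + x) * Real.log (1 + x) - x * Real.log x) ?_
      fun x hx => Hmax_top hx
    exact ((Real.continuous_mul_log.comp (continuous_const.add continuous_id)).sub
      Real.continuous_mul_log).continuousOn
  | coe k =>
    rw [meanRange_coe]
    set Z : ℝ → ℝ := fun y => ∑ t ∈ Finset.range (k + 1), y ^ t with hZ
    set g : ℝ → ℝ := fun y => Real.log (Z y) - y * Real.log y with hg
    have hZc : Continuous Z := by fun_prop
    have hZ0 : Z 0 = 1 := by simp [hZ, Finset.sum_range_succ']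
    have hgc : ContinuousAt g 0 :=
      (hZc.continuousAt.log (by rw [hZ0]; exact one_ne_zero)).sub
        Real.continuous_mul_log.continuousAt
    have hg0 : g 0 = 0 := by simp [hg, hZ0]
    -- Gibbs' inequality with `q = x`. The mirror bound below takes `q = (k - x)⁻¹`, and reversing
    -- the sum turns it into `g (k - x)`.
    have left : ∀ x ∈ Set.Icc (0 : ℝ) k, Hmax k x ≤ g x := by
      intro x hx
      rcases hx.1.eq_or_lt with rfl | h0
      · rw [Hmax_zero, hg0]
      · exact Hmax_le hx h0
    have right : ∀ x ∈ Set.Icc (0 : ℝ) k, Hmax k x ≤ g (k - x) := by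
      intro x hx
      rcases hx.2.eq_or_lt with rfl | h0
      · rw [Hmax_self, sub_self, hg0]
      · have hy : 0 < (k : ℝ) - x := sub_pos.2 h0
        refine (Hmax_le hx (inv_pos.2 hy)).trans_eq ?_
        have : ∑ t ∈ Finset.range (k + 1), ((k : ℝ) - x)⁻¹ ^ t =
            Z (k - x) * (((k : ℝ) - x) ^ k)⁻¹ := by
          rw [hZ, Finset.sum_mul, ← Finset.sum_range_reflect]
          refine Finset.sum_congr rfl fun t ht => ?_
          have ht' : t ≤ k := Nat.lt_succ_iff.1 (Finset.mem_range.1 ht)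
          rw [show k + 1 - 1 - t = k - t by omega, inv_pow, pow_sub₀ _ hy.ne' ht', mul_inv,
            inv_inv, mul_comm]
        have hZp : 0 < Z (k - x) := Finset.sum_pos (fun t _ => by positivity) (by simp)
        rw [this, Real.log_mul hZp.ne' (by positivity), Real.log_inv, Real.log_inv, Real.log_pow]
        simp only [hg]
        ring
    intro x hx
    rcases hx.1.eq_or_lt with rfl | h0
    · have := hgc.tendsto
      rw [hg0] at this
      rw [ContinuousWithinAt, Hmax_zero]
      exact tendsto_of_tendsto_of_tendsto_of_le_of_le' tendsto_const_nhds
        (this.mono_left nhdsWithin_le_nhds) (Eventually.of_forall fun _ => Hmax_nonneg _ _)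
        (eventually_mem_nhdsWithin.mono left)
    rcases hx.2.eq_or_lt with rfl | h1
    · have hl : Tendsto (fun x : ℝ => (k : ℝ) - x) (𝓝 (k : ℝ)) (𝓝 0) := by
        have : Continuous fun x : ℝ => (k : ℝ) - x := by fun_prop
        simpa using this.tendsto (k : ℝ)
      have := hgc.tendsto.comp hl
      rw [hg0] at this
      rw [ContinuousWithinAt, Hmax_self]
      exact tendsto_of_tendsto_of_tendsto_of_le_of_le' tendsto_const_nhds
        (this.mono_left nhdsWithin_le_nhds) (Eventually.of_forall fun _ => Hmax_nonneg _ _)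
        (eventually_mem_nhdsWithin.mono right)
    · have := (concaveOn_Hmax k).continuousOn_interior
      rw [interior_Ioo] at this
      exact (this.continuousAt (Ioo_mem_nhds h0 h1)).continuousWithinAt

/-! ### Lattice points of a box by their sum -/

open Classical in
/-- The number of lattice points `u` of the box `∏ [l i, l i + d i]` with `∑ u i = c`. -/
noncomputable def boxCount {n : ℕ} (l d : Fin n → ℕ) (c : ℤ) : ℕ :=
  ((Fintype.piFinset fun i => Finset.Ico (l i) (l i + d i + 1)).filter
    fun u => ((∑ i, u i : ℕ) : ℤ) = c).card

theorem boxCount_succ {n : ℕ} (l d : Fin (n + 1) → ℕ) (c : ℤ) :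
    boxCount l d c = ∑ k ∈ Finset.range (d 0 + 1),
      boxCount (fun i => l i.succ) (fun i => d i.succ) (c - l 0 - k) := by
  classical
  unfold boxCount
  rw [Finset.card_eq_sum_card_fiberwise (f := fun u => u 0)
    (t := Finset.Ico (l 0) (l 0 + d 0 + 1)) fun u hu => by
      have hu := (Finset.mem_filter.1 (Finset.mem_coe.1 hu)).1
      exact Finset.mem_coe.2 (Fintype.mem_piFinset.1 hu 0),
    Finset.sum_Ico_eq_sum_range, show l 0 + d 0 + 1 - l 0 = d 0 + 1 by omega]
  refine Finset.sum_congr rfl fun k hk => ?_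
  have hk := Finset.mem_range.1 hk
  refine Finset.card_nbij' Fin.tail (Fin.cons (α := fun _ => ℕ) (l 0 + k)) ?_ ?_ ?_ ?_
  · intro u hu
    simp only [Finset.coe_filter, Finset.mem_filter, Fintype.mem_piFinset,
      Set.mem_ofPred_eq] at hu ⊢
    refine ⟨fun i => hu.1.1 i.succ, ?_⟩
    have h := hu.1.2
    rw [Fin.sum_univ_succ, hu.2] at h
    push_cast at h ⊢
    simp only [Fin.tail]
    linarith
  · intro v hv
    simp only [Finset.coe_filter, Finset.mem_filter, Fintype.mem_piFinset,
      Set.mem_ofPred_eq] at hv ⊢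
    refine ⟨⟨Fin.forall_fin_succ.2 ⟨?_, fun i => ?_⟩, ?_⟩, by simp⟩
    · simp only [Fin.cons_zero, Finset.mem_Ico]
      omega
    · simpa using hv.1 i
    · rw [Fin.sum_univ_succ]
      have := hv.2
      push_cast at this ⊢
      simp only [Fin.cons_zero, Fin.cons_succ]
      push_cast
      linarith
  · intro u hu
    simp only [Finset.coe_filter, Finset.mem_filter, Set.mem_ofPred_eq] at hu
    rw [← hu.2]
    exact Fin.cons_self_tail u
  · intro v _
    exact Fin.tail_cons _ _

/-- The distribution of the coordinate sum over a box is symmetric and unimodal. -/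
theorem boxCount_symm_and_unimodal {n : ℕ} (l d : Fin n → ℕ) :
    (∀ c : ℤ, boxCount l d ((∑ i, (2 * l i + d i) : ℕ) - c) = boxCount l d c) ∧
      ∀ a b : ℤ, a ≤ b → a + b ≤ (∑ i, (2 * l i + d i) : ℕ) → boxCount l d a ≤ boxCount l d b := by
  induction n with
  | zero =>
    have e : ∀ c : ℤ, boxCount l d c = if c = 0 then 1 else 0 := by
      intro c
      unfold boxCount
      split_ifs with h <;> simp [h, eq_comm]
    refine ⟨fun c => by simp [e], fun a b h1 h2 => ?_⟩
    simp only [Finset.univ_eq_empty, Finset.sum_empty, Nat.cast_zero] at h2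
    rw [e, e]
    split_ifs <;> omega
  | succ n ih =>
    obtain ⟨ihs, ihm⟩ := ih (fun i => l i.succ) (fun i => d i.succ)
    set g := boxCount (fun i => l i.succ) (fun i => d i.succ) with hg
    set σ : ℤ := ((∑ i : Fin n, (2 * l i.succ + d i.succ) : ℕ) : ℤ) with hσ
    have hσ' : ((∑ i, (2 * l i + d i) : ℕ) : ℤ) = 2 * l 0 + d 0 + σ := by
      rw [Fin.sum_univ_succ]
      push_cast [hσ]
      ring
    rw [hσ']
    have symm : ∀ c : ℤ, boxCount l d (2 * l 0 + d 0 + σ - c) = boxCount l d c := by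
      intro c
      rw [boxCount_succ, boxCount_succ, ← Finset.sum_range_reflect]
      refine Finset.sum_congr rfl fun k hk => ?_
      have hk := Finset.mem_range.1 hk
      rw [← hg, ← ihs (c - l 0 - k)]
      congr 1
      omega
    -- The counts at `c` and `c + 1` sum `g` over windows of length `d 0 + 1` that differ only at
    -- their ends. The terms left over are `g (c - l 0 - d 0)` and `g (c + 1 - l 0)`, compared by
    -- induction.
    have step : ∀ c : ℤ, 2 * c + 1 ≤ 2 * l 0 + d 0 + σ → boxCount l d c ≤ boxCount l d (c + 1) := by
      intro c hc
      rw [boxCount_succ, boxCount_succ, Finset.sum_range_succ, Finset.sum_range_succ']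
      refine add_le_add (Finset.sum_le_sum fun k _ => le_of_eq ?_) (ihm _ _ ?_ ?_)
      · congr 1
        push_cast
        ring
      · push_cast
        omega
      · push_cast
        omega
    have mono : ∀ k : ℕ, ∀ a : ℤ, 2 * (a + k) ≤ 2 * l 0 + d 0 + σ →
        boxCount l d a ≤ boxCount l d (a + k) := by
      intro k
      induction k with
      | zero => intro a _; simp
      | succ k ihk =>
        intro a ha
        refine (ihk a (by push_cast at ha; omega)).trans ?_
        have := step (a + k) (by push_cast at ha; omega)
        push_cast
        rwa [← add_assoc]
    refine ⟨symm, fun a b hab h => ?_⟩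
    -- If `b` lies beyond the centre, its mirror image still lies above `a`, because `a + b` is at
    -- most twice the centre.
    rcases le_total (2 * b) (2 * l 0 + d 0 + σ) with hb | hb
    · obtain ⟨k, rfl⟩ := Int.le.dest hab
      exact mono k a hb
    · rw [← symm b]
      obtain ⟨k, hk⟩ := Int.le.dest (show a ≤ 2 * l 0 + d 0 + σ - b by omega)
      rw [← hk]
      exact mono k a (by omega)

/-- The vectors `u` with sum `c` such that both `u` and `w - u` have entries in `{0, …, κ}`. -/
def splittings {n : ℕ} (κ : ℕ) (w : Fin n → ℕ) (c : ℕ) : Set (Fin n → ℕ) :=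
  {u | (∀ i, u i ≤ κ ∧ u i ≤ w i ∧ w i ≤ κ + u i) ∧ ∑ i, u i = c}

theorem finite_splittings {n : ℕ} (κ : ℕ) (w : Fin n → ℕ) (c : ℕ) : (splittings κ w c).Finite :=
  (Set.Finite.pi' fun i => Set.finite_Iic (w i)).subset fun _ hu i => (hu.1 i).2.1

/-- Coordinate `i` of a splitting ranges over the interval from `w i - κ` (truncated at 0) to `min κ
(w i)`, which is symmetric about `w i / 2`. The sum over this box is therefore unimodal with centre
`(∑ i, w i) / 2`. If some `w i` exceeds `2 * κ` there is no splitting at all. -/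
theorem ncard_splittings_le {n : ℕ} (κ : ℕ) (w : Fin n → ℕ) {a b : ℕ} (hab : a ≤ b)
    (h : a + b ≤ ∑ i, w i) : (splittings κ w a).ncard ≤ (splittings κ w b).ncard := by
  classical
  by_cases hw : ∀ i, w i ≤ 2 * κ
  · have e : ∀ c, (splittings κ w c).ncard =
        boxCount (fun i => w i - κ) (fun i => min κ (w i) - (w i - κ)) c := by
      intro c
      rw [boxCount, ← Set.ncard_coe_finset]
      congr 1
      ext u
      simp only [splittings, Set.mem_ofPred_eq, Finset.coe_filter, Fintype.mem_piFinset,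
        Finset.mem_Ico, Nat.cast_inj]
      refine and_congr_left fun _ => forall_congr' fun i => ?_
      have := hw i
      omega
    have hσ : ∑ i, (2 * (w i - κ) + (min κ (w i) - (w i - κ))) = ∑ i, w i :=
      Finset.sum_congr rfl fun i _ => by have := hw i; omega
    rw [e, e]
    refine (boxCount_symm_and_unimodal _ _).2 _ _ (by exact_mod_cast hab) ?_
    rw [hσ]
    exact_mod_cast h
  · push Not at hw
    obtain ⟨i, hi⟩ := hw
    rw [show splittings κ w a = ∅ from ?_]
    · simp
    · refine Set.eq_empty_of_forall_notMem fun u hu => ?_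
      have := hu.1 i
      omega

/-- The injection depends on `w` only, so replacing a pair with sum `w` by another pair with sum `w`
can be undone: the new pair still reveals `w`. -/
theorem exists_injOn_splittings {n : ℕ} (κ : ℕ) {a b : ℕ} (hab : a ≤ b) :
    ∃ φ : (Fin n → ℕ) → (Fin n → ℕ) → (Fin n → ℕ), ∀ w, a + b ≤ ∑ i, w i →
      Set.MapsTo (φ w) (splittings κ w a) (splittings κ w b) ∧
        Set.InjOn (φ w) (splittings κ w a) := by
  have h : ∀ w : Fin n → ℕ, ∃ f : (Fin n → ℕ) → (Fin n → ℕ), a + b ≤ ∑ i, w i →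
      Set.MapsTo f (splittings κ w a) (splittings κ w b) ∧ Set.InjOn f (splittings κ w a) := by
    intro w
    by_cases hw : a + b ≤ ∑ i, w i
    · have hle := ncard_splittings_le κ w hab hw
      obtain ⟨f, hf1, hf2⟩ := (finite_splittings κ w a).exists_injOn_of_encard_le
        (t := splittings κ w b) (by
          rw [← (finite_splittings κ w a).cast_ncard_eq, ← (finite_splittings κ w b).cast_ncard_eq]
          exact_mod_cast hle)
      exact ⟨f, fun _ => ⟨fun x hx => hf1 hx, hf2⟩⟩
    · exact ⟨id, fun h => absurd h hw⟩
  choose φ hφ using h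
  exact ⟨φ, hφ⟩

/-! ### Bounded vectors and nomial coefficients -/

open Classical in
/-- The vectors of length `n` with entries in `{0, …, κ}` and sum `k`. -/
noncomputable def boundedVectors (κ : ℕ∞) (n k : ℕ) : Finset (Fin n → ℕ) :=
  (Finset.piAntidiag Finset.univ k).filter fun u => ∀ i, (u i : ℕ∞) ≤ κ

theorem mem_boundedVectors {κ : ℕ∞} {n k : ℕ} {u : Fin n → ℕ} :
    u ∈ boundedVectors κ n k ↔ (∀ i, (u i : ℕ∞) ≤ κ) ∧ ∑ i, u i = k := by
  simp [boundedVectors, and_comm]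

theorem nomial_eq_card (κ : ℕ∞) (n k : ℕ) : nomial κ n k = (boundedVectors κ n k).card := by
  classical
  rw [nomial, ← Fin.prod_const, PowerSeries.coeff_prod, boundedVectors, Finset.card_filter]
  refine Finset.sum_nbij' (fun l => ⇑l) (Finsupp.equivFunOnFinite.symm) ?_ ?_ ?_ ?_ ?_
  · intro l hl
    simpa using hl
  · intro u hu
    simpa using hu
  · intro l _
    simp
  · intro u _
    simp
  · intro l _
    simp only [PowerSeries.coeff_mk]
    rw [Fintype.prod_ite_zero]
    simp

theorem nomial_pos {k n j : ℕ} (h : j ≤ n * k) : 0 < nomial k n j := by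
  rw [nomial_eq_card, Finset.card_pos]
  induction n generalizing j with
  | zero =>
    obtain rfl : j = 0 := by omega
    exact ⟨0, by simp [mem_boundedVectors]⟩
  | succ n ih =>
    obtain ⟨u, hu⟩ := ih (j := j - min j k) (by rw [Nat.succ_mul] at h; omega)
    rw [mem_boundedVectors] at hu
    refine ⟨Fin.cons (α := fun _ => ℕ) (min j k) u, mem_boundedVectors.2
      ⟨Fin.forall_fin_succ.2 ⟨?_, fun i => ?_⟩, ?_⟩⟩
    · simp only [Fin.cons_zero]
      exact_mod_cast min_le_right j k
    · simpa using hu.1 i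
    · rw [Fin.sum_univ_succ]
      simp only [Fin.cons_zero, Fin.cons_succ, hu.2]
      omega

/-- Nomial coefficients are log-concave. -/
theorem nomial_mul_le (k n j : ℕ) : nomial k n j * nomial k n (j + 2) ≤ nomial k n (j + 1) ^ 2 := by
  obtain ⟨φ, hφ⟩ := exists_injOn_splittings (n := n) k (Nat.le_succ j)
  simp only [nomial_eq_card, sq, ← Finset.card_product]
  have mem : ∀ {x : (Fin n → ℕ) × (Fin n → ℕ)}, x ∈ boundedVectors k n j ×ˢ
      boundedVectors k n (j + 2) → x.1 ∈ splittings k (x.1 + x.2) j ∧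
        j + (j + 1) ≤ ∑ i, (x.1 + x.2) i := by
    rintro ⟨u, v⟩ h
    simp only [Finset.mem_product, mem_boundedVectors, Nat.cast_le] at h
    refine ⟨⟨fun i => ?_, h.1.2⟩, ?_⟩
    · have h1 := h.1.1 i
      have h2 := h.2.1 i
      simp only [Pi.add_apply]
      omega
    · simp only [Pi.add_apply, Finset.sum_add_distrib, h.1.2, h.2.2]
      omega
  have add : ∀ {x : (Fin n → ℕ) × (Fin n → ℕ)}, x ∈ boundedVectors k n j ×ˢ
      boundedVectors k n (j + 2) →
      φ (x.1 + x.2) x.1 + (x.1 + x.2 - φ (x.1 + x.2) x.1) = x.1 + x.2 := by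
    intro x hx
    obtain ⟨h1, h2⟩ := mem hx
    have h3 := (hφ _ h2).1 h1
    exact funext fun i => Nat.add_sub_cancel' (h3.1 i).2.1
  -- A pair with sums `j` and `j + 2` becomes a pair with both sums `j + 1` and the same total
  -- vector.
  refine Finset.card_le_card_of_injOn
    (fun x => (φ (x.1 + x.2) x.1, x.1 + x.2 - φ (x.1 + x.2) x.1)) ?_ ?_
  · intro x hx
    obtain ⟨h1, h2⟩ := mem hx
    have h3 := (hφ _ h2).1 h1
    have h4 := add hx
    simp only [Finset.coe_product, Finset.mem_coe, Set.mem_prod,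
      mem_boundedVectors, Nat.cast_le] at hx ⊢
    refine ⟨⟨fun i => (h3.1 i).1, h3.2⟩, fun i => ?_, ?_⟩
    · have := (h3.1 i).2.2
      simp only [Pi.add_apply, Pi.sub_apply] at this ⊢
      omega
    · have := congrArg (fun v : Fin n → ℕ => ∑ i, v i) h4
      simp only [Pi.add_apply, Finset.sum_add_distrib, hx.1.2, hx.2.2, h3.2] at this
      simp only [Pi.sub_apply, Pi.add_apply] at this ⊢
      omega
  · intro x hx y hy hxy
    simp only [Prod.mk.injEq] at hxy
    have e : x.1 + x.2 = y.1 + y.2 := by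
      rw [← add hx, hxy.2, hxy.1, add hy]
    obtain ⟨h1, h2⟩ := mem hx
    obtain ⟨h1', -⟩ := mem hy
    rw [← e] at h1' hxy
    have e1 := (hφ _ h2).2 h1 h1' hxy.1
    rw [e1] at e
    exact Prod.ext e1 (add_left_cancel e)

/-! ### Balancing the column sums -/

/-- Let `w` be the sum of columns `j₁` and `j₂`. Column `j₁` is a splitting of `w`, and `h` places
its sum on the increasing side of the unimodal count, so it can be replaced injectively by a
splitting with sum one larger. Column `j₂` becomes the complement; `w`, hence every row sum, is
unchanged, and `w` with the new column determines the old one. -/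
theorem numTables_le_of_transfer {m n : ℕ} (k : ℕ) (R : Fin m → ℕ) {C C' : Fin n → ℕ}
    {j₁ j₂ : Fin n} (hj : j₁ ≠ j₂) (h : C j₁ + 2 ≤ C j₂) (h₁ : C' j₁ = C j₁ + 1)
    (h₂ : C' j₂ + 1 = C j₂) (h₃ : ∀ j, j ≠ j₁ → j ≠ j₂ → C' j = C j) :
    numTables k R C ≤ numTables k R C' := by
  obtain ⟨φ, hφ⟩ := exists_injOn_splittings (n := m) k (Nat.le_succ (C j₁))
  let w : Matrix (Fin m) (Fin n) ℕ → Fin m → ℕ := fun A i => A i j₁ + A i j₂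
  let u : Matrix (Fin m) (Fin n) ℕ → Fin m → ℕ := fun A => φ (w A) fun i => A i j₁
  let F : Matrix (Fin m) (Fin n) ℕ → Matrix (Fin m) (Fin n) ℕ := fun A i j =>
    if j = j₁ then u A i else if j = j₂ then w A i - u A i else A i j
  have F₁ : ∀ A i, F A i j₁ = u A i := fun A i => if_pos rfl
  have F₂ : ∀ A i, F A i j₂ = w A i - u A i := fun A i => by simp [F, hj.symm]
  have F₃ : ∀ A i j, j ≠ j₁ → j ≠ j₂ → F A i j = A i j := fun A i j h1 h2 => by simp [F, h1, h2]
  have mem : ∀ A ∈ tables k R C, (fun i => A i j₁) ∈ splittings k (w A) (C j₁) ∧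
      C j₁ + (C j₁ + 1) ≤ ∑ i, w A i := by
    intro A hA
    refine ⟨⟨fun i => ?_, hA.2.2 j₁⟩, ?_⟩
    · have h1 : A i j₁ ≤ k := by exact_mod_cast hA.1 i j₁
      have h2 : A i j₂ ≤ k := by exact_mod_cast hA.1 i j₂
      simp only [w]
      omega
    · simp only [w, Finset.sum_add_distrib, hA.2.2]
      omega
  have mem' : ∀ A ∈ tables k R C, u A ∈ splittings k (w A) (C j₁ + 1) := fun A hA =>
    (hφ _ (mem A hA).2).1 (mem A hA).1
  refine Set.ncard_le_ncard_of_injOn F ?_ ?_ (finite_tables _ _ _)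
  · intro A hA
    have hu := mem' A hA
    refine ⟨fun i j => ?_, fun i => ?_, fun j => ?_⟩
    · by_cases hj1 : j = j₁
      · subst hj1
        rw [F₁]
        exact_mod_cast (hu.1 i).1
      by_cases hj2 : j = j₂
      · subst hj2
        rw [F₂]
        have := (hu.1 i).2.2
        exact_mod_cast (by omega : w A i - u A i ≤ k)
      · rw [F₃ A i j hj1 hj2]
        exact hA.1 i j
    · rw [← hA.2.1 i, ← Finset.add_sum_erase _ _ (Finset.mem_univ j₁),
        ← Finset.add_sum_erase _ _ (Finset.mem_univ j₁),
        ← Finset.add_sum_erase _ _ (Finset.mem_erase.2 ⟨hj.symm, Finset.mem_univ j₂⟩),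
        ← Finset.add_sum_erase _ _ (Finset.mem_erase.2 ⟨hj.symm, Finset.mem_univ j₂⟩),
        F₁, F₂, ← add_assoc, ← add_assoc, Nat.add_sub_cancel' (hu.1 i).2.1]
      refine congrArg _ (Finset.sum_congr rfl fun j hj' => ?_)
      simp only [Finset.mem_erase] at hj'
      exact F₃ A i j hj'.2.1 hj'.1
    · by_cases hj1 : j = j₁
      · subst hj1
        simp only [F₁, hu.2, h₁]
      by_cases hj2 : j = j₂
      · subst hj2
        simp only [F₂]
        have : ∑ i, (u A i + (w A i - u A i)) = ∑ i, w A i :=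
          Finset.sum_congr rfl fun i _ => Nat.add_sub_cancel' (hu.1 i).2.1
        rw [Finset.sum_add_distrib, hu.2] at this
        have e : ∑ i, w A i = C j₁ + C j := by
          simp only [w, Finset.sum_add_distrib, hA.2.2]
        omega
      · simp only [F₃ A _ j hj1 hj2, h₃ j hj1 hj2, hA.2.2 j]
  · intro A hA B hB hAB
    have key : ∀ i j, F A i j = F B i j := fun i j => by rw [hAB]
    have eu : u A = u B := funext fun i => by rw [← F₁, ← F₁, key]
    have ew : w A = w B := by
      funext i
      have h1 := key i j₂
      rw [F₂, F₂, eu] at h1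
      have h2 := ((mem' A hA).1 i).2.1
      have h3 := ((mem' B hB).1 i).2.1
      rw [eu] at h2
      omega
    have e1 : (fun i => A i j₁) = fun i => B i j₁ := by
      have hB1 := (mem B hB).1
      rw [← ew] at hB1
      refine (hφ _ (mem A hA).2).2 (mem A hA).1 hB1 ?_
      have := eu
      simp only [u] at this
      rw [← ew] at this
      exact this
    ext i j
    have e1i : A i j₁ = B i j₁ := congrFun e1 i
    by_cases hj1 : j = j₁
    · subst hj1; exact e1i
    by_cases hj2 : j = j₂
    · subst hj2
      have := congrFun ew i
      simp only [w] at this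
      omega
    · rw [← F₃ A i j hj1 hj2, ← F₃ B i j hj1 hj2, key]

/-- With given row sums and total, the number of tables is largest for equal column sums. -/
theorem numTables_le_const {m n c : ℕ} (k : ℕ) (R : Fin m → ℕ) (C : Fin n → ℕ)
    (hC : ∑ j, C j = n * c) : numTables k R C ≤ numTables k R (fun _ : Fin n => c) := by
  -- With truncated subtraction this is the total excess above `c`. A transfer from an overfull to
  -- an underfull column lowers it by one.
  induction hd : ∑ j, (C j - c) using Nat.strong_induction_on generalizing C with
  | _ d ih =>
    by_cases hle : ∀ j, C j ≤ c
    · have : ∀ j ∈ Finset.univ, C j = c :=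
        (Finset.sum_eq_sum_iff_of_le fun j _ => hle j).1 (by simp [hC])
      rw [show C = fun _ => c from funext fun j => this j (Finset.mem_univ j)]
    · push Not at hle
      obtain ⟨j₂, hj₂⟩ := hle
      obtain ⟨j₁, hj₁⟩ : ∃ j, C j < c := by
        by_contra! hge
        have := Finset.sum_lt_sum (fun j _ => hge j) ⟨j₂, Finset.mem_univ _, hj₂⟩
        simp [hC] at this
      have hj : j₁ ≠ j₂ := by rintro rfl; omega
      let C' := Function.update (Function.update C j₁ (C j₁ + 1)) j₂ (C j₂ - 1)
      have h₁ : C' j₁ = C j₁ + 1 := by simp [C', hj]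
      have h₂ : C' j₂ = C j₂ - 1 := by simp [C']
      have h₃ : ∀ j, j ≠ j₁ → j ≠ j₂ → C' j = C j := fun j h h' => by simp [C', h, h']
      refine (numTables_le_of_transfer k R hj (by omega) h₁ (by omega) h₃).trans
        (ih (∑ j, (C' j - c)) ?_ C' ?_ rfl)
      · rw [← hd]
        refine Finset.sum_lt_sum (fun j _ => ?_) ⟨j₂, Finset.mem_univ _, by omega⟩
        by_cases e1 : j = j₁
        · subst e1; omega
        by_cases e2 : j = j₂
        · subst e2; omega
        · rw [h₃ j e1 e2]
      · rw [← hC, ← Finset.add_sum_erase _ _ (Finset.mem_univ j₁),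
          ← Finset.add_sum_erase _ C (Finset.mem_univ j₁),
          ← Finset.add_sum_erase _ _ (Finset.mem_erase.2 ⟨hj.symm, Finset.mem_univ j₂⟩),
          ← Finset.add_sum_erase _ C (Finset.mem_erase.2 ⟨hj.symm, Finset.mem_univ j₂⟩),
          h₁, h₂, Finset.sum_congr rfl fun j hj' => h₃ j (by simp at hj'; tauto)
            (by simp at hj'; tauto)]
        simp only [← add_assoc]
        congr 1
        omega

/-- No entry exceeds its row sum, so for fixed margins an unbounded `κ` may be replaced by a finite
one. -/
theorem tables_eq_of_sum_le {m n : ℕ} {k : ℕ} (R : Fin m → ℕ) (C : Fin n → ℕ)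
    (h : ∀ i, R i ≤ k) : tables ⊤ R C = tables k R C := by
  ext A
  simp only [tables, Set.mem_ofPred_eq, le_top, implies_true, true_and, Nat.cast_le]
  refine ⟨fun hA => ⟨fun i j => ?_, hA⟩, fun hA => hA.2⟩
  exact (Finset.single_le_sum (f := fun j => A i j) (fun _ _ => Nat.zero_le _)
    (Finset.mem_univ j)).trans ((hA.1 i).trans_le (h i))

theorem numTables_le_const' {m n c : ℕ} (κ : ℕ∞) (R : Fin m → ℕ) (C : Fin n → ℕ)
    (hC : ∑ j, C j = n * c) : numTables κ R C ≤ numTables κ R (fun _ : Fin n => c) := by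
  induction κ using ENat.recTopCoe with
  | top =>
    have h : ∀ i, R i ≤ ∑ i, R i := fun i =>
      Finset.single_le_sum (fun _ _ => Nat.zero_le _) (Finset.mem_univ i)
    rw [numTables, numTables, tables_eq_of_sum_le R C h, tables_eq_of_sum_le R _ h]
    exact numTables_le_const _ R C hC
  | coe k => exact numTables_le_const k R C hC

/-- A lower bound for the number of square tables with constant margins. -/
theorem nomial_pow_le (κ : ℕ∞) (s c : ℕ) :
    nomial κ s c ^ s ≤ numTables κ (fun _ : Fin s => c) (fun _ : Fin s => c) *
      (s * c + 1) ^ s := by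
  classical
  -- Matrices with all row sums `c` are sorted by their column sums, which lie in `{0, …, s * c}`.
  -- No fibre is larger than the one with constant column sums.
  have h := Finset.card_le_mul_card_image_of_maps_to
    (s := Fintype.piFinset fun _ : Fin s => boundedVectors κ s c)
    (t := Fintype.piFinset fun _ : Fin s => Finset.range (s * c + 1))
    (f := fun A j => ∑ i, A i j) ?_
    (numTables κ (fun _ : Fin s => c) (fun _ : Fin s => c)) ?_
  · simpa [Fintype.card_piFinset, nomial_eq_card] using h
  · intro A hA
    simp only [Fintype.mem_piFinset, mem_boundedVectors, Finset.mem_range] at hA ⊢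
    refine fun j => Nat.lt_succ_iff.2 ?_
    calc ∑ i, A i j ≤ ∑ _i : Fin s, c := Finset.sum_le_sum fun i _ =>
          (Finset.single_le_sum (f := fun j => A i j) (fun _ _ => Nat.zero_le _)
            (Finset.mem_univ j)).trans_eq (hA i).2
      _ = _ := by simp
  · intro C _
    rcases Finset.eq_empty_or_nonempty ((Fintype.piFinset fun _ : Fin s =>
      boundedVectors κ s c).filter fun A => (fun j => ∑ i, A i j) = C) with he | ⟨A, hA⟩
    · rw [he]; simp
    have hC : ∑ j, C j = s * c := by
      simp only [Finset.mem_filter, Fintype.mem_piFinset, mem_boundedVectors] at hA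
      rw [← hA.2, Finset.sum_comm, Finset.sum_congr rfl fun i _ => (hA.1 i).2]
      simp
    refine le_trans ?_ (numTables_le_const' κ (fun _ : Fin s => c) C hC)
    rw [numTables, ← Set.ncard_coe_finset]
    refine Set.ncard_le_ncard ?_ (finite_tables _ _ _)
    intro A hA
    simp only [Finset.coe_filter, Fintype.mem_piFinset, mem_boundedVectors,
      Set.mem_ofPred_eq] at hA
    exact ⟨fun i j => (hA.1 i).1 j, fun i => (hA.1 i).2, fun j => congrFun hA.2 j⟩

/-! ### Bounds for nomial coefficients -/

/-- A log-concave distribution on `{0, …, B}` whose mean is an integer `k` gives `k` at least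
the probability `(B + 1) ^ (-2)`. -/
theorem sum_le_of_logConcave {a : ℕ → ℝ} {B k : ℕ} (hkB : k ≤ B) (hpos : ∀ j ≤ B, 0 < a j)
    (hlc : ∀ j, a j * a (j + 2) ≤ a (j + 1) ^ 2)
    (hmean : ∑ j ∈ Finset.range (B + 1), ((j : ℝ) - k) * a j = 0) :
    ∑ j ∈ Finset.range (B + 1), a j ≤ ((B : ℝ) + 1) ^ 2 * a k := by
  have hkB' : (k : ℝ) ≤ B := by exact_mod_cast hkB
  have hk := hpos k hkB
  -- Summed over `j`, the term with `ε` vanishes by `hmean`, and `B + 1` copies of `(B + 1) * a k`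
  -- remain.
  have finish : ∀ ε : ℝ, (∀ j ≤ B, a j ≤ ε * (((j : ℝ) - k) * a j) + (B + 1) * a k) →
      ∑ j ∈ Finset.range (B + 1), a j ≤ ((B : ℝ) + 1) ^ 2 * a k := by
    intro ε h
    calc ∑ j ∈ Finset.range (B + 1), a j
        ≤ ∑ j ∈ Finset.range (B + 1), (ε * (((j : ℝ) - k) * a j) + (B + 1) * a k) :=
          Finset.sum_le_sum fun j hj => h j (Nat.lt_succ_iff.1 (Finset.mem_range.1 hj))
      _ = _ := by
          rw [Finset.sum_add_distrib, ← Finset.mul_sum, hmean, Finset.sum_const,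
            Finset.card_range]
          push_cast [nsmul_eq_mul]
          ring
  have up : ∀ j, j + 1 ≤ k → a j ≤ a (j + 1) → ∀ i ≤ j, a i ≤ a (j + 1) := by
    intro j hj h
    induction j with
    | zero => intro i hi; obtain rfl : i = 0 := by omega
              exact h
    | succ j ih =>
      have h' : a j ≤ a (j + 1) := by
        have h1 := hlc j
        have h2 := hpos (j + 1) (by omega)
        have h3 := hpos (j + 2) (by omega)
        have h4 : a (j + 1) ≤ a (j + 2) := h
        have : a j * a (j + 2) ≤ a (j + 1) * a (j + 2) := by nlinarith
        exact le_of_mul_le_mul_right this h3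
      intro i hi
      rcases Nat.lt_or_eq_of_le hi with hi | rfl
      · exact (ih (by omega) h' i (by omega)).trans h
      · exact h
  have down : ∀ j, a (j + 1) ≤ a j → ∀ i, j + i ≤ B → a (j + i) ≤ a j ∧
      (j + i + 1 ≤ B → a (j + i + 1) ≤ a (j + i)) := by
    intro j h i
    induction i with
    | zero => intro _; exact ⟨le_rfl, fun _ => h⟩
    | succ i ih =>
      intro hi
      obtain ⟨h1, h2⟩ := ih (by omega)
      have h2 := h2 hi
      refine ⟨h2.trans h1, fun hi' => ?_⟩
      have h3 := hlc (j + i)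
      have h4 := hpos (j + i) (by omega)
      have h5 := hpos (j + i + 1) (by omega)
      have : a (j + i) * a (j + i + 2) ≤ a (j + i) * a (j + i + 1) := by nlinarith
      exact le_of_mul_le_mul_left this h4
  -- With `ε = 1`: for `j > k` the factor `j - k ≥ 1` already dominates, and for `j ≤ k` the factor
  -- `1 + (k - j)` is at most `B + 1`. The mirror case uses `ε = -1`.
  have case₁ : (∀ j ≤ k, a j ≤ a k) →
      ∑ j ∈ Finset.range (B + 1), a j ≤ ((B : ℝ) + 1) ^ 2 * a k := by
    intro h
    refine finish 1 fun j hj => ?_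
    have hj0 := hpos j hj
    rcases le_or_gt j k with hjk | hjk
    · have h1 := h j hjk
      have h2 : (j : ℝ) ≤ k := by exact_mod_cast hjk
      have h3 : (0 : ℝ) ≤ j := by positivity
      have : (1 + ((k : ℝ) - j)) * a j ≤ (B + 1) * a k :=
        mul_le_mul (by linarith) h1 hj0.le (by positivity)
      linarith
    · have h2 : (k : ℝ) + 1 ≤ j := by exact_mod_cast hjk
      have : 0 ≤ ((B : ℝ) + 1) * a k := by positivity
      nlinarith
  have case₂ : (∀ j, k ≤ j → j ≤ B → a j ≤ a k) →
      ∑ j ∈ Finset.range (B + 1), a j ≤ ((B : ℝ) + 1) ^ 2 * a k := by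
    intro h
    refine finish (-1) fun j hj => ?_
    have hj0 := hpos j hj
    rcases le_or_gt k j with hjk | hjk
    · have h1 := h j hjk hj
      have h2 : (j : ℝ) ≤ B := by exact_mod_cast hj
      have h3 : (0 : ℝ) ≤ k := by positivity
      have : (1 + ((j : ℝ) - k)) * a j ≤ (B + 1) * a k :=
        mul_le_mul (by linarith) h1 hj0.le (by positivity)
      linarith
    · have h2 : (j : ℝ) + 1 ≤ k := by exact_mod_cast hjk
      have : 0 ≤ ((B : ℝ) + 1) * a k := by positivity
      nlinarith
  cases k with
  | zero => exact case₁ fun j hj => by obtain rfl : j = 0 := by omega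
                                       exact le_rfl
  | succ k =>
    -- By unimodality, a rise into the mean bounds every term to its left, and a fall into it every
    -- term to its right.
    rcases le_total (a k) (a (k + 1)) with h | h
    · refine case₁ fun j hj => ?_
      rcases Nat.lt_or_eq_of_le hj with hj | rfl
      · exact up k le_rfl h j (by omega)
      · exact le_rfl
    · refine case₂ fun j hj hjB => ?_
      rcases Nat.lt_or_eq_of_le hj with hj | rfl
      · have h1 := (down k h 1 hkB).2 (by omega)
        obtain ⟨i, rfl⟩ := Nat.exists_eq_add_of_le hj.le
        exact (down (k + 1) h1 i hjB).1
      · exact le_rfl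

theorem sum_nomial_mul_pow (K n : ℕ) (y : ℝ) :
    ∑ j ∈ Finset.range (n * K + 1), (nomial K n j : ℝ) * y ^ j =
      (∑ t ∈ Finset.range (K + 1), y ^ t) ^ n := by
  classical
  rw [← Fin.prod_const, Finset.prod_univ_sum, ← Finset.sum_fiberwise_of_maps_to
    (t := Finset.range (n * K + 1)) (g := fun u : Fin n → ℕ => ∑ i, u i)]
  · refine Finset.sum_congr rfl fun j _ => ?_
    rw [Finset.sum_congr rfl (g := fun _ => y ^ j) fun u hu => by
        rw [Finset.prod_pow_eq_pow_sum, (Finset.mem_filter.1 hu).2],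
      Finset.sum_const, nsmul_eq_mul, nomial_eq_card]
    congr 3
    ext u
    simp [mem_boundedVectors]
  · intro u hu
    simp only [Fintype.mem_piFinset, Finset.mem_range, Nat.lt_succ_iff] at hu ⊢
    exact (Finset.sum_le_sum fun i _ => hu i).trans_eq (by simp)

/-- The weights `nomial K n j * q ^ j` are log-concave with total `S ^ n`, and `hmean`, saying that
one coordinate has mean `k / n`, makes their mean the integer `k`. So `sum_le_of_logConcave`
applies. -/
theorem sum_pow_le_nomial {K n k : ℕ} {q : ℝ} (hq : 0 < q) (hk : k ≤ n * K)
    (hmean : ∑ t ∈ Finset.range (K + 1), ((n : ℝ) * t - k) * q ^ t = 0) :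
    (∑ t ∈ Finset.range (K + 1), q ^ t) ^ n ≤
      ((n * K : ℕ) + 1 : ℝ) ^ 2 * (nomial K n k * q ^ k) := by
  rw [← sum_nomial_mul_pow]
  refine sum_le_of_logConcave (a := fun j => (nomial K n j : ℝ) * q ^ j) hk ?_ ?_ ?_
  · intro j hj
    have : (0 : ℝ) < nomial K n j := by exact_mod_cast nomial_pos hj
    positivity
  · intro j
    have h : (nomial K n j : ℝ) * nomial K n (j + 2) ≤ (nomial K n (j + 1) : ℝ) ^ 2 := by
      exact_mod_cast nomial_mul_le K n j
    calc (nomial K n j : ℝ) * q ^ j * (nomial K n (j + 2) * q ^ (j + 2))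
        = (nomial K n j : ℝ) * nomial K n (j + 2) * (q ^ (j + 1)) ^ 2 := by ring
      _ ≤ (nomial K n (j + 1) : ℝ) ^ 2 * (q ^ (j + 1)) ^ 2 := by gcongr
      _ = _ := by ring
  · set S := ∑ t ∈ Finset.range (K + 1), q ^ t with hS
    set D := ∑ t ∈ Finset.range (K + 1), (t : ℝ) * q ^ (t - 1) with hD
    -- The mean is the logarithmic derivative of the generating function; it is computed from both
    -- of its forms.
    have d₁ : HasDerivAt (fun y : ℝ => ∑ j ∈ Finset.range (n * K + 1), (nomial K n j : ℝ) * y ^ j)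
        (∑ j ∈ Finset.range (n * K + 1), (nomial K n j : ℝ) * (j * q ^ (j - 1))) q :=
      HasDerivAt.fun_sum fun j _ => (hasDerivAt_pow j q).const_mul _
    have d₂ : HasDerivAt (fun y : ℝ => (∑ t ∈ Finset.range (K + 1), y ^ t) ^ n)
        (n * S ^ (n - 1) * D) q :=
      (HasDerivAt.fun_sum fun t _ => hasDerivAt_pow t q).fun_pow n
    rw [funext (sum_nomial_mul_pow K n)] at d₁
    have e := d₁.unique d₂
    have hpow : ∀ j : ℕ, (j : ℝ) * q ^ (j - 1) * q = j * q ^ j := by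
      intro j
      cases j with
      | zero => simp
      | succ j => rw [Nat.add_sub_cancel]; ring
    have eD : D * q * n = k * S := by
      rw [hD, hS, Finset.sum_mul, Finset.sum_mul, Finset.mul_sum, ← sub_eq_zero,
        ← Finset.sum_sub_distrib, ← hmean]
      exact Finset.sum_congr rfl fun t _ => by rw [hpow]; ring
    have hSn : (n : ℝ) * S ^ (n - 1) * D * q = k * S ^ n := by
      cases n with
      | zero => obtain rfl : k = 0 := by omega
                simp
      | succ n =>
        calc ((n + 1 : ℕ) : ℝ) * S ^ (n + 1 - 1) * D * q =
            S ^ n * (D * q * (n + 1 : ℕ)) := by rw [Nat.add_sub_cancel]; ring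
          _ = _ := by rw [eD]; ring
    calc ∑ j ∈ Finset.range (n * K + 1), ((j : ℝ) - k) * (nomial K n j * q ^ j)
        = (∑ j ∈ Finset.range (n * K + 1), (nomial K n j : ℝ) * (j * q ^ (j - 1))) * q -
          k * ∑ j ∈ Finset.range (n * K + 1), (nomial K n j : ℝ) * q ^ j := by
          rw [Finset.sum_mul, Finset.mul_sum, ← Finset.sum_sub_distrib]
          refine Finset.sum_congr rfl fun j _ => ?_
          rw [mul_assoc, hpow]
          ring
      _ = 0 := by rw [e, sum_nomial_mul_pow, hSn, sub_self]

theorem nomial_zero_right (κ : ℕ∞) (n : ℕ) : nomial κ n 0 = 1 := by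
  rw [nomial_eq_card, Finset.card_eq_one]
  refine ⟨0, Finset.ext fun u => ?_⟩
  simp only [mem_boundedVectors, Finset.sum_eq_zero_iff, Finset.mem_univ, true_imp_iff,
    Finset.mem_singleton]
  exact ⟨fun h => funext h.2, by rintro rfl; simp⟩

theorem nomial_one (n k : ℕ) : nomial (1 : ℕ) n k = n.choose k := by
  classical
  have : (PowerSeries.mk fun t : ℕ => if (t : ℕ∞) ≤ (1 : ℕ) then (1 : ℕ) else 0) =
      ((1 + Polynomial.X : Polynomial ℕ) : PowerSeries ℕ) := by
    ext t
    rw [PowerSeries.coeff_mk, Polynomial.coeff_coe, Polynomial.coeff_add, Polynomial.coeff_one,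
      Polynomial.coeff_X]
    rcases t with _ | _ | t
    · simp
    · simp
    · have h : ¬ ((t + 1 + 1 : ℕ) : ℕ∞) ≤ (1 : ℕ) := by
        rw [Nat.cast_le]
        omega
      rw [if_neg h]
      simp
  rw [nomial, this, ← Polynomial.coe_pow, Polynomial.coeff_coe, Polynomial.coeff_one_add_X_pow]
  simp

theorem nomial_top (d k : ℕ) : nomial ⊤ (d + 1) k = (d + k).choose d := by
  classical
  have : (PowerSeries.mk fun t : ℕ => if (t : ℕ∞) ≤ ⊤ then (1 : ℕ) else 0).map
      (Nat.castRingHom ℤ) = PowerSeries.mk 1 := by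
    ext t
    simp
  have h := congrArg (PowerSeries.coeff k) (PowerSeries.mk_one_pow_eq_mk_choose_add ℤ d)
  rw [← this, ← map_pow, PowerSeries.coeff_map, PowerSeries.coeff_mk] at h
  rw [nomial]
  rw [eq_natCast] at h
  exact_mod_cast h

/-- For the tilt `q` with mean `k / n`, `Hmax_eq` gives `exp (n * Hmax) * q ^ k = S ^ n`, which
`sum_pow_le_nomial` bounds. At the endpoints the entropy is 0 and positivity of the coefficient
suffices. -/
theorem exp_Hmax_le_coe {K n k : ℕ} (hk : k ≤ n * K) :
    Real.exp (n * Hmax K (k / n)) ≤ ((n * K : ℕ) + 1 : ℝ) ^ 2 * nomial K n k := by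
  have hn0 : (1 : ℝ) ≤ nomial K n k := by exact_mod_cast nomial_pos hk
  have triv : Hmax K (k / n) = 0 →
      Real.exp (n * Hmax K (k / n)) ≤ ((n * K : ℕ) + 1 : ℝ) ^ 2 * nomial K n k := by
    intro h
    rw [h, mul_zero, Real.exp_zero]
    have : (0 : ℝ) ≤ (n * K : ℕ) := by positivity
    nlinarith
  rcases Nat.eq_zero_or_pos k with rfl | hk0
  · exact triv (by simp [Hmax_zero])
  have hn : 0 < n := Nat.pos_of_ne_zero (by rintro rfl; omega)
  have hn' : (0 : ℝ) < n := by exact_mod_cast hn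
  rcases hk.eq_or_lt with rfl | hk
  · refine triv ?_
    rw [Nat.cast_mul, mul_div_cancel_left₀ _ hn'.ne', Hmax_self]
  have hx : (k / n : ℝ) ∈ Set.Ioo (0 : ℝ) K := by
    refine ⟨by positivity, ?_⟩
    rw [div_lt_iff₀ hn']
    exact_mod_cast hk.trans_eq (mul_comm _ _)
  obtain ⟨q, hq, hm, hH⟩ := Hmax_eq hx
  have hm' : ∑ t ∈ Finset.range (K + 1), ((n : ℝ) * t - k) * q ^ t = 0 := by
    rw [← mul_zero (n : ℝ), ← hm, Finset.mul_sum]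
    exact Finset.sum_congr rfl fun t _ => by field_simp
  have hS : 0 < ∑ t ∈ Finset.range (K + 1), q ^ t :=
    Finset.sum_pos (fun t _ => by positivity) (by simp)
  have h := sum_pow_le_nomial hq hk.le hm'
  have e : Real.exp (n * Hmax K (k / n)) * q ^ k =
      (∑ t ∈ Finset.range (K + 1), q ^ t) ^ n := by
    rw [hH, ← Real.exp_log (pow_pos hq k), ← Real.exp_add, ← Real.exp_log (pow_pos hS n),
      Real.log_pow, Real.log_pow]
    congr 1
    field_simp
    ring
  rw [← e, ← mul_assoc] at h
  exact le_of_mul_le_mul_right h (by positivity)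

/-- With unbounded entries the coefficient is, up to a factor at most `n + k`, the binomial
coefficient of `n + k` over `k`. This reduces the bound to `κ = 1` with `n + k` coordinates and tilt
`x = k / n`. -/
theorem exp_Hmax_le_top {n : ℕ} (hn : 0 < n) (k : ℕ) :
    Real.exp (n * Hmax ⊤ (k / n)) ≤ ((n : ℝ) + k + 1) ^ 3 * nomial ⊤ n k := by
  rcases Nat.eq_zero_or_pos k with rfl | hk
  · rw [nomial_zero_right]
    simp only [Nat.cast_zero, zero_div, Hmax_zero, mul_zero, Real.exp_zero]
    push_cast
    rw [mul_one]
    exact one_le_pow₀ (by linarith [(by positivity : (0 : ℝ) ≤ n)])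
  have hn' : (0 : ℝ) < n := by exact_mod_cast hn
  have hk' : (0 : ℝ) < k := by exact_mod_cast hk
  set x : ℝ := k / n with hx
  have hx0 : 0 < x := by positivity
  have h := sum_pow_le_nomial (K := 1) (n := n + k) (k := k) hx0 (by omega) (by
    simp only [Finset.sum_range_succ, Finset.sum_range_zero]
    push_cast
    rw [hx]
    field_simp
    ring)
  rw [nomial_one] at h
  have hc : (n + k).choose k ≤ (n + k) * nomial ⊤ n k := by
    obtain ⟨d, rfl⟩ : ∃ d, n = d + 1 := ⟨n - 1, by omega⟩
    have := Nat.add_one_mul_choose_eq (d + k) d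
    rw [nomial_top, ← Nat.choose_symm_add]
    have e : d + 1 + k = d + k + 1 := by omega
    rw [e, this]
    exact Nat.le_mul_of_pos_right _ (Nat.succ_pos d)
  have hc' : ((n + k).choose k : ℝ) ≤ ((n : ℝ) + k) * nomial ⊤ n k := by exact_mod_cast hc
  have e : Real.exp (n * Hmax ⊤ x) * x ^ k = (1 + x) ^ (n + k) := by
    rw [Hmax_top hx0.le, ← Real.exp_log (pow_pos hx0 k), ← Real.exp_add,
      ← Real.exp_log (pow_pos (show 0 < 1 + x by positivity) (n + k)), Real.log_pow, Real.log_pow]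
    congr 1
    have : (n : ℝ) * x = k := by rw [hx]; field_simp
    push_cast
    rw [← this]
    ring
  have e2 : ∑ t ∈ Finset.range (1 + 1), x ^ t = 1 + x := by
    simp [Finset.sum_range_succ]
  rw [e2, ← e, ← mul_assoc] at h
  refine (le_of_mul_le_mul_right h (by positivity)).trans ?_
  push_cast
  calc (((n : ℝ) + k) * 1 + 1) ^ 2 * (n + k).choose k
      ≤ (((n : ℝ) + k) * 1 + 1) ^ 2 * (((n : ℝ) + k) * nomial ⊤ n k) := by gcongr
    _ ≤ (((n : ℝ) + k) * 1 + 1) ^ 2 * (((n : ℝ) + k + 1) * nomial ⊤ n k) := by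
        refine mul_le_mul_of_nonneg_left (mul_le_mul_of_nonneg_right ?_ ?_) ?_
        · linarith
        · positivity
        · positivity
    _ = _ := by ring

/-- A common polynomial factor for both cases; `κ.toNat` is 0 when `κ = ⊤`. -/
theorem exp_Hmax_le {κ : ℕ∞} {n k : ℕ} (hn : 0 < n) (hk : ∀ K : ℕ, κ = K → k ≤ n * K) :
    Real.exp (n * Hmax κ (k / n)) ≤
      (((κ.toNat : ℝ) + 1) * n + k + 1) ^ 3 * nomial κ n k := by
  induction κ using ENat.recTopCoe with
  | top => simpa using exp_Hmax_le_top hn k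
  | coe K =>
    refine (exp_Hmax_le_coe (hk K rfl)).trans (mul_le_mul_of_nonneg_right ?_ (by positivity))
    simp only [ENat.toNat_natCast]
    have h1 : ((n * K : ℕ) + 1 : ℝ) ≤ ((K : ℝ) + 1) * n + k + 1 := by
      push_cast
      nlinarith [(by positivity : (0 : ℝ) ≤ n), (by positivity : (0 : ℝ) ≤ k)]
    have h2 : (1 : ℝ) ≤ ((n * K : ℕ) + 1 : ℝ) := by
      have : (0 : ℝ) ≤ (n * K : ℕ) := by positivity
      linarith
    calc ((n * K : ℕ) + 1 : ℝ) ^ 2 ≤ (((K : ℝ) + 1) * n + k + 1) ^ 2 := by gcongr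
      _ ≤ _ := pow_le_pow_right₀ (h2.trans h1) (by norm_num)

/-! ### Counting by entropy -/

/-- A set of integer vectors whose entries have average `z j` on the `j`-th class of coordinates
has at most `exp (∑ Hmax z)` elements. -/
theorem log_card_le {ι J : Type*} [Fintype ι] [Fintype J] [DecidableEq J] {κ : ℕ∞}
    (𝒜 : Finset (ι → ℕ)) (cls : ι → J) (z : J → ℝ) (hz : ∀ j, z j ∈ meanRange κ)
    (hκ : ∀ A ∈ 𝒜, ∀ i, (A i : ℕ∞) ≤ κ)
    (hmean : ∀ j, ∑ A ∈ 𝒜, ∑ i with cls i = j, (A i : ℝ) =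
      (𝒜.card : ℝ) * ∑ i with cls i = j, z j) :
    Real.log 𝒜.card ≤ ∑ i, Hmax κ (z (cls i)) := by
  classical
  rcases 𝒜.eq_empty_or_nonempty with rfl | hne
  · simpa using Finset.sum_nonneg fun i _ => Hmax_nonneg κ (z (cls i))
  choose α β hH hw using fun j => exists_TG_eq_exp (hz j)
  have hcard : (0 : ℝ) < 𝒜.card := by exact_mod_cast hne.card_pos
  -- entries are constant where the average is extremal
  have hzero : ∀ A ∈ 𝒜, ∀ i, z (cls i) = 0 → A i = 0 := by
    intro A hA i hi
    have h := hmean (cls i)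
    rw [hi] at h
    simp only [Finset.sum_const_zero, mul_zero] at h
    have h1 := (Finset.sum_eq_zero_iff_of_nonneg
      (fun A _ => Finset.sum_nonneg fun i _ => by positivity)).1 h A hA
    have h2 := (Finset.sum_eq_zero_iff_of_nonneg (fun i _ => by positivity)).1 h1 i (by simp)
    exact_mod_cast h2
  have hmax : ∀ A ∈ 𝒜, ∀ i, ∀ k : ℕ, κ = k → z (cls i) = k → A i = k := by
    rintro A hA i k rfl hi
    have hle : ∀ A ∈ 𝒜, ∀ i, (A i : ℝ) ≤ k := fun A hA i => by exact_mod_cast hκ A hA i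
    have h := hmean (cls i)
    rw [hi] at h
    have h0 : ∑ A ∈ 𝒜, ∑ i' with cls i' = cls i, ((k : ℝ) - A i') = 0 := by
      simp only [Finset.sum_sub_distrib]
      rw [h]
      simp
    have h1 := (Finset.sum_eq_zero_iff_of_nonneg
      (fun A hA => Finset.sum_nonneg fun i _ => sub_nonneg.2 (hle A hA i))).1 h0 A hA
    have h2 := (Finset.sum_eq_zero_iff_of_nonneg
      (fun i _ => sub_nonneg.2 (hle A hA i))).1 h1 i (by simp)
    have h3 : (k : ℝ) = A i := by linarith
    exact_mod_cast h3.symm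
  -- The two facts above supply the endpoint conditions of `exists_TG_eq_exp`, so no member of `𝒜`
  -- has probability 0.
  have hval : ∀ A ∈ 𝒜, ∏ i, (TG κ (z (cls i)) (A i)).toReal =
      Real.exp (∑ i, (α (cls i) + β (cls i) * A i)) := by
    intro A hA
    rw [Real.exp_sum]
    exact Finset.prod_congr rfl fun i _ => hw _ _ (hκ A hA i) (hzero A hA i) (hmax A hA i)
  have hone : ∑ A ∈ 𝒜, ∏ i, (TG κ (z (cls i)) (A i)).toReal ≤ 1 := by
    set B := 𝒜.sup fun A => Finset.univ.sup A
    calc ∑ A ∈ 𝒜, ∏ i, (TG κ (z (cls i)) (A i)).toReal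
        ≤ ∑ A ∈ Fintype.piFinset fun _ : ι => Finset.range (B + 1),
            ∏ i, (TG κ (z (cls i)) (A i)).toReal := by
          refine Finset.sum_le_sum_of_subset_of_nonneg (fun A hA => ?_) fun A _ _ =>
            Finset.prod_nonneg fun i _ => ENNReal.toReal_nonneg
          rw [Fintype.mem_piFinset]
          intro i
          rw [Finset.mem_range, Nat.lt_succ_iff]
          exact (Finset.le_sup (f := A) (Finset.mem_univ i)).trans
            (Finset.le_sup (f := fun A : ι → ℕ => Finset.univ.sup A) hA)
      _ = ∏ i, ∑ t ∈ Finset.range (B + 1), (TG κ (z (cls i)) t).toReal := by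
          rw [Finset.prod_univ_sum]
      _ ≤ 1 := Finset.prod_le_one
          (fun i _ => Finset.sum_nonneg fun t _ => ENNReal.toReal_nonneg)
          fun i _ => sum_le_hasSum _ (fun t _ => ENNReal.toReal_nonneg) (hasSum_toReal _)
  set m : ℝ := ∑ i, (α (cls i) + β (cls i) * z (cls i)) with hm
  have hmH : ∑ i, Hmax κ (z (cls i)) = -m := by
    rw [hm, ← Finset.sum_neg_distrib]
    exact Finset.sum_congr rfl fun i _ => hH _
  -- The coefficients `α`, `β` depend only on the class, so prescribing class averages is enough.
  have havg : ∑ A ∈ 𝒜, ∑ i, (α (cls i) + β (cls i) * A i) = 𝒜.card * m := by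
    have e1 : ∀ f : ι → ℝ, ∑ i, β (cls i) * f i =
        ∑ j, β j * ∑ i with cls i = j, f i := by
      intro f
      rw [← Finset.sum_fiberwise Finset.univ cls]
      refine Finset.sum_congr rfl fun j _ => ?_
      rw [Finset.mul_sum]
      exact Finset.sum_congr rfl fun i hi => by rw [(Finset.mem_filter.1 hi).2]
    have e2 : ∀ j, ∑ i with cls i = j, z (cls i) = ∑ i with cls i = j, z j := fun j =>
      Finset.sum_congr rfl fun i hi => by rw [(Finset.mem_filter.1 hi).2]
    simp only [hm, Finset.sum_add_distrib, e1, e2, mul_add, Finset.sum_const, nsmul_eq_mul]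
    congr 1
    rw [Finset.sum_comm, Finset.mul_sum]
    refine Finset.sum_congr rfl fun j _ => ?_
    rw [← Finset.mul_sum, hmean]
    simp only [Finset.sum_const, nsmul_eq_mul]
    ring
  -- Jensen's inequality as `exp y ≥ 1 + y`, where `y` is the log-probability minus its average `m`.
  have hJ : (𝒜.card : ℝ) * Real.exp m ≤ 1 := by
    calc (𝒜.card : ℝ) * Real.exp m
        = ∑ A ∈ 𝒜, Real.exp m * ((∑ i, (α (cls i) + β (cls i) * A i) - m) + 1) := by
          rw [← Finset.mul_sum, Finset.sum_add_distrib, Finset.sum_sub_distrib, havg]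
          simp
          ring
      _ ≤ ∑ A ∈ 𝒜, ∏ i, (TG κ (z (cls i)) (A i)).toReal := by
          refine Finset.sum_le_sum fun A hA => ?_
          rw [hval A hA]
          refine (mul_le_mul_of_nonneg_left (Real.add_one_le_exp _) (Real.exp_pos m).le).trans_eq ?_
          rw [← Real.exp_add]
          ring_nf
      _ ≤ 1 := hone
  rw [hmH, Real.log_le_iff_le_exp hcard, Real.exp_neg]
  rwa [← one_div, le_div_iff₀ (Real.exp_pos m)]

/-- All coordinates form a single class with average `k / n`. -/
theorem log_nomial_le {κ : ℕ∞} {n k : ℕ} (hn : 0 < n) (hk : ∀ K : ℕ, κ = K → k ≤ n * K) :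
    Real.log (nomial κ n k) ≤ n * Hmax κ (k / n) := by
  have hn' : (0 : ℝ) < n := by exact_mod_cast hn
  have h := log_card_le (κ := κ) (boundedVectors κ n k) (fun _ : Fin n => ())
    (fun _ => (k / n : ℝ)) (fun _ => ⟨by positivity, fun K e => ?_⟩)
    (fun u hu i => (mem_boundedVectors.1 hu).1 i) (fun _ => ?_)
  · simpa [nomial_eq_card] using h
  · rw [div_le_iff₀ hn']
    exact_mod_cast (hk K e).trans_eq (mul_comm _ _)
  · simp only [Finset.filter_true, Finset.sum_const, Finset.card_univ, Fintype.card_fin,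
      nsmul_eq_mul]
    rw [Finset.sum_congr rfl (g := fun _ => (k : ℝ)) fun u hu => by
      rw [← (mem_boundedVectors.1 hu).2]; push_cast; rfl]
    simp only [Finset.sum_const, nsmul_eq_mul]
    field_simp

/-- The asymptotics of nomial coefficients. -/
theorem tendsto_log_nomial {κ : ℕ∞} {x : ℝ} (hx : x ∈ meanRange κ) {n k : ℕ → ℕ}
    (hn : Tendsto n atTop atTop) (hk : ∀ᶠ s in atTop, ∀ K : ℕ, κ = K → k s ≤ n s * K)
    (hkn : Tendsto (fun s => (k s : ℝ) / n s) atTop (𝓝 x)) :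
    Tendsto (fun s => Real.log (nomial κ (n s) (k s)) / n s) atTop (𝓝 (Hmax κ x)) := by
  have hn' : Tendsto (fun s => (n s : ℝ)) atTop atTop := tendsto_natCast_atTop_atTop.comp hn
  have hn0 := hn.eventually_gt_atTop 0
  have hmem : ∀ᶠ s in atTop, (k s : ℝ) / n s ∈ meanRange κ := by
    filter_upwards [hn0, hk] with s h0 h
    refine ⟨by positivity, fun K e => ?_⟩
    rw [div_le_iff₀ (by exact_mod_cast h0)]
    exact_mod_cast (h K e).trans_eq (mul_comm _ _)
  have hH : Tendsto (fun s => Hmax κ ((k s : ℝ) / n s)) atTop (𝓝 (Hmax κ x)) :=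
    (continuousOn_Hmax κ x hx).tendsto.comp (tendsto_nhdsWithin_iff.2 ⟨hkn, hmem⟩)
  set c : ℝ := (κ.toNat : ℝ) + 1 with hc
  -- Factoring out `n s` leaves the logarithm of `c + k s / n s + 1 / n s`, whose argument has the
  -- positive limit `c + x`.
  have hlog : Tendsto (fun s => Real.log (c * n s + k s + 1) / n s) atTop (𝓝 0) := by
    have h1 : Tendsto (fun s => Real.log (n s) / n s) atTop (𝓝 0) :=
      (Real.isLittleO_log_id_atTop.tendsto_div_nhds_zero).comp hn'
    have h2 : Tendsto (fun s => c + (k s : ℝ) / n s + 1 / (n s : ℝ)) atTop (𝓝 (c + x + 0)) :=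
      (tendsto_const_nhds.add hkn).add (tendsto_const_nhds.div_atTop hn')
    have hcx : c + x + 0 ≠ 0 := by
      have : (0 : ℝ) ≤ κ.toNat := by positivity
      have := hx.1
      rw [hc]
      linarith
    have h3 := (h2.log hcx).div_atTop hn'
    have h4 := h1.add h3
    rw [add_zero] at h4
    refine h4.congr' ?_
    filter_upwards [hn0] with s h0
    have h0' : (0 : ℝ) < n s := by exact_mod_cast h0
    rw [← add_div, ← Real.log_mul h0'.ne' (by positivity)]
    congr 2
    field_simp
  have hlow := hH.sub (hlog.const_mul 3)
  rw [mul_zero, sub_zero] at hlow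
  refine tendsto_of_tendsto_of_tendsto_of_le_of_le' hlow hH ?_ ?_
  · filter_upwards [hn0, hk] with s h0 h
    have h0' : (0 : ℝ) < n s := by exact_mod_cast h0
    have hb := exp_Hmax_le h0 h
    have hpos : (0 : ℝ) < nomial κ (n s) (k s) :=
      pos_of_mul_pos_right ((Real.exp_pos _).trans_le hb) (by positivity)
    have hl := Real.log_le_log (Real.exp_pos _) hb
    rw [Real.log_exp, Real.log_mul (by positivity) hpos.ne', Real.log_pow, ← hc] at hl
    rw [le_div_iff₀ h0']
    push_cast at hl
    have : (Hmax κ (k s / n s) - 3 * (Real.log (c * n s + k s + 1) / n s)) * n s =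
        n s * Hmax κ (k s / n s) - 3 * Real.log (c * n s + k s + 1) := by
      field_simp
    linarith
  · filter_upwards [hn0, hk] with s h0 h
    rw [div_le_iff₀ (by exact_mod_cast h0), mul_comm]
    exact log_nomial_le h0 h

/-! ### Cloned tables -/

theorem sum_clone_index {M : Type*} [AddCommMonoid M] {s m : ℕ} (f : Fin (s * m) → M) :
    ∑ a, f a = ∑ i, ∑ a', f (finProdFinEquiv (a', i)) := by
  rw [← Equiv.sum_comp finProdFinEquiv, Fintype.sum_prod_type, Finset.sum_comm]

theorem modNat_finProdFinEquiv {s m : ℕ} (a : Fin s) (i : Fin m) :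
    (finProdFinEquiv (a, i)).modNat = i :=
  congrArg Prod.snd (finProdFinEquiv.symm_apply_apply (a, i))

theorem divNat_finProdFinEquiv {s m : ℕ} (a : Fin s) (i : Fin m) :
    (finProdFinEquiv (a, i)).divNat = a :=
  congrArg Prod.fst (finProdFinEquiv.symm_apply_apply (a, i))

theorem finProdFinEquiv_divNat_modNat {s m : ℕ} (a : Fin (s * m)) :
    finProdFinEquiv (a.divNat, a.modNat) = a :=
  finProdFinEquiv.apply_symm_apply a

theorem polytope_mem_meanRange {m n : ℕ} {κ : ℕ∞} {R : Fin m → ℕ} {C : Fin n → ℕ}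
    {Z : Matrix (Fin m) (Fin n) ℝ} (hZ : Z ∈ polytope κ R C) (i : Fin m) (j : Fin n) :
    Z i j ∈ meanRange κ :=
  ⟨hZ.1 i j, fun k e => hZ.2.1 k e i j⟩

/-- The number of cloned tables is bounded by the entropy of the averaged table. -/
theorem exists_log_numTables_clone_le {m n s : ℕ} (hs : 0 < s) {κ : ℕ∞} {R : Fin m → ℕ}
    {C : Fin n → ℕ} (hT : 0 < numTables κ (clone s R) (clone s C)) :
    ∃ Z ∈ polytope κ R C, Real.log (numTables κ (clone s R) (clone s C)) ≤
      (s : ℝ) ^ 2 * ∑ i, ∑ j, Hmax κ (Z i j) := by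
  classical
  set 𝒯 := (finite_tables κ (clone s R) (clone s C)).toFinset with h𝒯
  have hcard : numTables κ (clone s R) (clone s C) = 𝒯.card :=
    Set.ncard_eq_toFinset_card _ _
  have hmem : ∀ {A}, A ∈ 𝒯 ↔ A ∈ tables κ (clone s R) (clone s C) := by simp [h𝒯]
  have hc0 : (0 : ℝ) < 𝒯.card := by rw [← hcard]; exact_mod_cast hT
  have hs0 : (0 : ℝ) < s := by exact_mod_cast hs
  let g : Matrix (Fin (s * m)) (Fin (s * n)) ℕ → (Fin s × Fin m) × (Fin s × Fin n) → ℕ :=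
    fun A x => A (finProdFinEquiv x.1) (finProdFinEquiv x.2)
  have hg : Function.Injective g := by
    intro A B h
    ext a b
    have := congrFun h ((a.divNat, a.modNat), (b.divNat, b.modNat))
    simpa only [g, finProdFinEquiv_divNat_modNat] using this
  -- The average runs over all tables and over the `s ^ 2` copies of each position. Each of the `s`
  -- copies of row `i` has sum `s * R i`, which accounts for the factor `s ^ 2`.
  let Z : Matrix (Fin m) (Fin n) ℝ := fun i j =>
    (∑ A ∈ 𝒯, ∑ a, ∑ b, (g A ((a, i), (b, j)) : ℝ)) / (𝒯.card * (s : ℝ) ^ 2)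
  have hD : (0 : ℝ) < 𝒯.card * (s : ℝ) ^ 2 := by positivity
  have hZ : Z ∈ polytope κ R C := by
    refine ⟨fun i j => by positivity, fun k e i j => ?_, fun i => ?_, fun j => ?_⟩
    · rw [div_le_iff₀ hD]
      calc ∑ A ∈ 𝒯, ∑ a, ∑ b, (g A ((a, i), (b, j)) : ℝ)
          ≤ ∑ A ∈ 𝒯, ∑ _a : Fin s, ∑ _b : Fin s, (k : ℝ) := by
            refine Finset.sum_le_sum fun A hA => Finset.sum_le_sum fun a _ =>
              Finset.sum_le_sum fun b _ => ?_
            have := (hmem.1 hA).1 (finProdFinEquiv (a, i)) (finProdFinEquiv (b, j))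
            rw [e] at this
            exact_mod_cast this
        _ = _ := by
            simp
            ring
    · have h1 : ∀ A ∈ 𝒯, ∀ a, ∑ j, ∑ b, (g A ((a, i), (b, j)) : ℝ) = s * R i := by
        intro A hA a
        have := (hmem.1 hA).2.1 (finProdFinEquiv (a, i))
        rw [sum_clone_index, clone, modNat_finProdFinEquiv] at this
        exact_mod_cast this
      simp only [Z]
      rw [← Finset.sum_div, div_eq_iff hD.ne', Finset.sum_comm]
      calc ∑ A ∈ 𝒯, ∑ j, ∑ a, ∑ b, (g A ((a, i), (b, j)) : ℝ)
          = ∑ A ∈ 𝒯, ∑ _a : Fin s, (s : ℝ) * R i := by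
            refine Finset.sum_congr rfl fun A hA => ?_
            rw [Finset.sum_comm]
            exact Finset.sum_congr rfl fun a _ => h1 A hA a
        _ = _ := by
            simp
            ring
    · have h1 : ∀ A ∈ 𝒯, ∀ b, ∑ i, ∑ a, (g A ((a, i), (b, j)) : ℝ) = s * C j := by
        intro A hA b
        have := (hmem.1 hA).2.2 (finProdFinEquiv (b, j))
        rw [sum_clone_index, clone, modNat_finProdFinEquiv] at this
        exact_mod_cast this
      simp only [Z]
      rw [← Finset.sum_div, div_eq_iff hD.ne', Finset.sum_comm]
      calc ∑ A ∈ 𝒯, ∑ i, ∑ a, ∑ b, (g A ((a, i), (b, j)) : ℝ)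
          = ∑ A ∈ 𝒯, ∑ _b : Fin s, (s : ℝ) * C j := by
            exact Finset.sum_congr rfl fun A hA =>
              (Finset.sum_congr rfl fun i _ => Finset.sum_comm).trans
                (Finset.sum_comm.trans (Finset.sum_congr rfl fun b _ => h1 A hA b))
        _ = _ := by
            simp
            ring
  refine ⟨Z, hZ, ?_⟩
  have hfib : ∀ (p : Fin m × Fin n) (f : (Fin s × Fin m) × (Fin s × Fin n) → ℝ),
      ∑ x with (x.1.2, x.2.2) = p, f x = ∑ a, ∑ b, f ((a, p.1), (b, p.2)) := by
    rintro ⟨i, j⟩ f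
    simp only [Finset.sum_filter, Fintype.sum_prod_type, Prod.mk.injEq, ite_and]
    refine Finset.sum_congr rfl fun a _ => ?_
    rw [Finset.sum_eq_single i]
    · simp
    · intro i' _ h
      simp [h]
    · simp
  have h := log_card_le (κ := κ) (𝒯.image g) (fun x => (x.1.2, x.2.2)) (fun p => Z p.1 p.2)
    (fun p => polytope_mem_meanRange hZ _ _) ?_ ?_
  · rw [Finset.card_image_of_injective _ hg, ← hcard] at h
    refine h.trans_eq ?_
    simp only [Fintype.sum_prod_type, Finset.sum_const, Finset.card_univ, Fintype.card_fin,
      nsmul_eq_mul, ← Finset.mul_sum]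
    ring
  · intro A hA x
    obtain ⟨B, hB, rfl⟩ := Finset.mem_image.1 hA
    exact (hmem.1 hB).1 _ _
  · intro p
    rw [Finset.sum_image hg.injOn, Finset.card_image_of_injective _ hg, hfib]
    simp only [hfib, Z, Finset.sum_const, Finset.card_univ, Fintype.card_fin, nsmul_eq_mul]
    field_simp

/-- Cloned tables can be built from square blocks with constant margins. -/
theorem prod_numTables_le {m n s : ℕ} (κ : ℕ∞) {R : Fin m → ℕ} {C : Fin n → ℕ}
    (K : Matrix (Fin m) (Fin n) ℕ) (hR : ∀ i, ∑ j, K i j = s * R i)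
    (hC : ∀ j, ∑ i, K i j = s * C j) :
    ∏ p : Fin m × Fin n, numTables κ (fun _ : Fin s => K p.1 p.2) (fun _ : Fin s => K p.1 p.2) ≤
      numTables κ (clone s R) (clone s C) := by
  classical
  have hcard : ∀ {a b : ℕ} (R : Fin a → ℕ) (C : Fin b → ℕ),
      numTables κ R C = (finite_tables κ R C).toFinset.card := fun _ _ =>
    Set.ncard_eq_toFinset_card _ _
  simp only [hcard]
  rw [← Fintype.card_piFinset]
  -- Rows of type `i` and columns of type `j` meet in an `s × s` block with margins `K i j`; a row
  -- of type `i` then has sum `∑ j, K i j = s * R i`.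
  refine Finset.card_le_card_of_injOn
    (fun B => (fun a b => B (a.modNat, b.modNat) a.divNat b.divNat :
      Matrix (Fin (s * m)) (Fin (s * n)) ℕ)) ?_ ?_
  · intro B hB
    simp only [Finset.mem_coe, Fintype.mem_piFinset, Set.Finite.mem_toFinset] at hB
    refine (Set.Finite.mem_toFinset _).2 ⟨fun a b => (hB _).1 _ _, fun a => ?_, fun b => ?_⟩
    · rw [sum_clone_index, clone, ← hR]
      refine Finset.sum_congr rfl fun j _ => ?_
      simp only [modNat_finProdFinEquiv, divNat_finProdFinEquiv]
      exact (hB (a.modNat, j)).2.1 _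
    · rw [sum_clone_index, clone, ← hC]
      refine Finset.sum_congr rfl fun i _ => ?_
      simp only [modNat_finProdFinEquiv, divNat_finProdFinEquiv]
      exact (hB (i, b.modNat)).2.2 _
  · intro B _ B' _ h
    funext p
    ext a b
    have := congrFun (congrFun h (finProdFinEquiv (a, p.1))) (finProdFinEquiv (b, p.2))
    simpa only [modNat_finProdFinEquiv, divNat_finProdFinEquiv] using this

theorem nomial_pos_of_le {κ : ℕ∞} {n k : ℕ} (hn : n = 0 → k = 0)
    (hk : ∀ K : ℕ, κ = K → k ≤ n * K) : 0 < nomial κ n k := by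
  rcases Nat.eq_zero_or_pos n with rfl | h0
  · rw [hn rfl, nomial_zero_right]
    exact one_pos
  · have : (0 : ℝ) < nomial κ n k :=
      pos_of_mul_pos_right ((Real.exp_pos _).trans_le (exp_Hmax_le h0 hk)) (by positivity)
    exact_mod_cast this

/-! ### Rational points of the polytope -/

/-- A `ℚ`-linear map fixing 1 preserves every linear equation with rational coefficients, so applied
entrywise it keeps the margins exactly. Extend 1 to a `ℚ`-basis of `ℝ` and send each basis vector to
a nearby rational; every real is a finite combination, so convergence follows. -/
theorem exists_tendsto_rat_linearMap : ∃ φ : ℕ → ℝ →ₗ[ℚ] ℚ, (∀ k, φ k 1 = 1) ∧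
    ∀ x, Tendsto (fun k => (φ k x : ℝ)) atTop (𝓝 x) := by
  classical
  have hli : LinearIndepOn ℚ id ({1} : Set ℝ) := by
    rw [linearIndepOn_singleton_iff]
    exact one_ne_zero
  set b := Module.Basis.extend hli with hb
  have happrox : ∀ (k : ℕ) (v : ℝ), ∃ r : ℚ, |(r : ℝ) - v| < 1 / ((k : ℝ) + 1) ∧
      (v = 1 → r = 1) := by
    intro k v
    by_cases hv : v = 1
    · exact ⟨1, by simp [hv]; positivity, fun _ => rfl⟩
    · obtain ⟨r, h1, h2⟩ := exists_rat_btwn (show v < v + 1 / ((k : ℝ) + 1) by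
        have : (0 : ℝ) < 1 / ((k : ℝ) + 1) := by positivity
        linarith)
      exact ⟨r, by rw [abs_of_pos] <;> linarith, fun h => absurd h hv⟩
  choose r hr hr1 using happrox
  have hrt : ∀ v, Tendsto (fun k => (r k v : ℝ)) atTop (𝓝 v) := fun v => by
    rw [tendsto_iff_dist_tendsto_zero]
    exact squeeze_zero (fun _ => dist_nonneg) (fun k => (hr k v).le)
      tendsto_one_div_add_atTop_nhds_zero_nat
  refine ⟨fun k => b.constr ℚ fun v => r k v, fun k => ?_, fun x => ?_⟩
  · have h1 : (1 : ℝ) ∈ hli.extend (Set.subset_univ _) := hli.subset_extend _ rfl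
    have e : b ⟨1, h1⟩ = 1 := Module.Basis.extend_apply_self hli _
    have := b.constr_basis ℚ (fun v => r k v) ⟨1, h1⟩
    rw [e] at this
    rw [this]
    exact hr1 k _ rfl
  · have e : ∀ k, ((b.constr ℚ (fun v => r k v) x : ℚ) : ℝ) =
        ∑ v ∈ (b.repr x).support, ((b.repr x v : ℚ) : ℝ) * (r k v : ℝ) := by
      intro k
      rw [Module.Basis.constr_apply, Finsupp.sum]
      push_cast [smul_eq_mul]
      rfl
    have ex : x = ∑ v ∈ (b.repr x).support, ((b.repr x v : ℚ) : ℝ) * (v : ℝ) := by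
      conv_lhs => rw [← b.linearCombination_repr x]
      rw [Finsupp.linearCombination_apply, Finsupp.sum]
      refine Finset.sum_congr rfl fun v _ => ?_
      rw [Rat.smul_def, hb, Module.Basis.extend_apply_self]
    simp only [e]
    conv_rhs => rw [ex]
    exact tendsto_finsetSum _ fun v _ => (hrt v).const_mul _

/-- Every point of the polytope is a limit of rational points of the polytope. -/
theorem exists_tendsto_rat_polytope {m n : ℕ} {κ : ℕ∞} {R : Fin m → ℕ} {C : Fin n → ℕ}
    {Z : Matrix (Fin m) (Fin n) ℝ} (hZ : Z ∈ polytope κ R C) :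
    ∃ W : ℕ → Matrix (Fin m) (Fin n) ℚ,
      (∀ᶠ k in atTop, (W k).map (fun q : ℚ => (q : ℝ)) ∈ polytope κ R C) ∧
      ∀ i j, Tendsto (fun k => (W k i j : ℝ)) atTop (𝓝 (Z i j)) := by
  obtain ⟨φ, hφ1, hφ⟩ := exists_tendsto_rat_linearMap
  have hnat : ∀ k (a : ℕ), φ k a = a := by
    intro k a
    have := (φ k).map_smul (a : ℚ) 1
    rw [hφ1, Rat.smul_def] at this
    simpa using this
  refine ⟨fun k i j => φ k (Z i j), ?_, fun i j => hφ _⟩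
  -- Linearity keeps zero entries zero, and positive entries stay positive eventually. The bound `κ`
  -- is treated in the same way.
  have h0 : ∀ᶠ k in atTop, ∀ i j, (0 : ℝ) ≤ φ k (Z i j) := by
    refine eventually_all.2 fun i => eventually_all.2 fun j => ?_
    rcases (hZ.1 i j).eq_or_lt with h | h
    · exact Eventually.of_forall fun k => by simp [← h]
    · exact ((hφ (Z i j)).eventually (lt_mem_nhds h)).mono fun k hk => hk.le
  have h1 : ∀ᶠ k in atTop, ∀ K : ℕ, κ = K → ∀ i j, (φ k (Z i j) : ℝ) ≤ K := by
    induction κ using ENat.recTopCoe with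
    | top => exact Eventually.of_forall fun k K h => by simp at h
    | coe K =>
      have : ∀ᶠ k in atTop, ∀ i j, (φ k (Z i j) : ℝ) ≤ K := by
        refine eventually_all.2 fun i => eventually_all.2 fun j => ?_
        rcases (hZ.2.1 K rfl i j).eq_or_lt with h | h
        · exact Eventually.of_forall fun k => by rw [h, hnat]; simp
        · exact ((hφ (Z i j)).eventually (gt_mem_nhds h)).mono fun k hk => hk.le
      filter_upwards [this] with k hk K' e i j
      rw [← ENat.natCast_inj.1 e]
      exact hk i j
  filter_upwards [h0, h1] with k hk0 hk1
  refine ⟨hk0, hk1, fun i => ?_, fun j => ?_⟩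
  · have := hnat k (R i)
    rw [← hZ.2.2.1 i, map_sum] at this
    change ∑ j, ((φ k (Z i j) : ℚ) : ℝ) = R i
    exact_mod_cast this
  · have := hnat k (C j)
    rw [← hZ.2.2.2 j, map_sum] at this
    change ∑ i, ((φ k (Z i j) : ℚ) : ℝ) = C j
    exact_mod_cast this

/-- A rational point of the polytope is the limit of scaled integer points. -/
theorem exists_tendsto_tables {m n : ℕ} {κ : ℕ∞} {R : Fin m → ℕ} {C : Fin n → ℕ}
    (hT : 0 < numTables κ R C) {W : Matrix (Fin m) (Fin n) ℚ}
    (hW : W.map (fun q : ℚ => (q : ℝ)) ∈ polytope κ R C) :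
    ∃ K : ℕ → Matrix (Fin m) (Fin n) ℕ,
      (∀ s, (∀ k : ℕ, κ = k → ∀ i j, K s i j ≤ s * k) ∧ (∀ i, ∑ j, K s i j = s * R i) ∧
        ∀ j, ∑ i, K s i j = s * C j) ∧
      ∀ i j, Tendsto (fun s => (K s i j : ℝ) / s) atTop (𝓝 (W i j)) := by
  obtain ⟨A, hA⟩ := Set.nonempty_of_ncard_ne_zero hT.ne'
  obtain ⟨hW0, hWk, hWR, hWC⟩ := hW
  simp only [Matrix.map_apply] at hW0 hWk hWR hWC
  set d : ℕ := ∏ p : Fin m × Fin n, (W p.1 p.2).den with hd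
  have hd0 : 0 < d := Finset.prod_pos fun p _ => (W p.1 p.2).den_pos
  have hd0' : (0 : ℝ) < d := by exact_mod_cast hd0
  have hint : ∀ i j, ∃ a : ℕ, (a : ℝ) = d * (W i j : ℝ) := by
    intro i j
    obtain ⟨c, hc⟩ : (W i j).den ∣ d := Finset.dvd_prod_of_mem
      (fun p : Fin m × Fin n => (W p.1 p.2).den) (Finset.mem_univ (i, j))
    have h0 : 0 ≤ W i j := by exact_mod_cast hW0 i j
    refine ⟨(W i j).num.toNat * c, ?_⟩
    have h1 : (((W i j).num.toNat : ℤ) : ℚ) = W i j * (W i j).den := by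
      rw [Int.toNat_of_nonneg (Rat.num_nonneg.2 h0), Rat.mul_den_eq_num]
    have h2 : (((W i j).num.toNat * c : ℕ) : ℚ) = d * W i j := by
      rw [hc]
      push_cast at h1 ⊢
      rw [h1]
      ring
    exact_mod_cast h2
  choose V hV using hint
  have hVR : ∀ i, ∑ j, V i j = d * R i := by
    intro i
    have : (∑ j, (V i j : ℝ)) = d * R i := by
      simp only [hV, ← Finset.mul_sum, hWR]
    exact_mod_cast this
  have hVC : ∀ j, ∑ i, V i j = d * C j := by
    intro j
    have : (∑ i, (V i j : ℝ)) = d * C j := by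
      simp only [hV, ← Finset.mul_sum, hWC]
    exact_mod_cast this
  have hdiv : ∀ s r : ℕ, s / d * (d * r) + s % d * r = s * r := by
    intro s r
    conv_rhs => rw [← Nat.div_add_mod s d]
    ring
  -- Dividing `s` by the common denominator `d`, the quotient multiplies the integer matrix `V = d
  -- W` and the remainder multiplies a given table `A`. The margins are exact for every `s`, and the
  -- bounded remainder is negligible after division by `s`.
  refine ⟨fun s i j => s / d * V i j + s % d * A i j, fun s => ⟨?_, ?_, ?_⟩, ?_⟩
  · intro k e i j
    have h1 : V i j ≤ d * k := by
      have : (V i j : ℝ) ≤ d * k := by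
        rw [hV]
        exact mul_le_mul_of_nonneg_left (hWk k e i j) hd0'.le
      exact_mod_cast this
    have h2 : A i j ≤ k := by
      have := hA.1 i j
      rw [e] at this
      exact_mod_cast this
    rw [← hdiv s k]
    exact add_le_add (Nat.mul_le_mul_left _ h1) (Nat.mul_le_mul_left _ h2)
  · intro i
    rw [Finset.sum_add_distrib, ← Finset.mul_sum, ← Finset.mul_sum, hVR, hA.2.1, hdiv]
  · intro j
    rw [Finset.sum_add_distrib, ← Finset.mul_sum, ← Finset.mul_sum, hVC, hA.2.2, hdiv]
  · intro i j
    have hmod : Tendsto (fun s : ℕ => ((s % d : ℕ) : ℝ) / s) atTop (𝓝 0) := by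
      refine squeeze_zero (fun s => by positivity) (g := fun s : ℕ => (d : ℝ) / s) (fun s => ?_)
        (tendsto_const_nhds.div_atTop tendsto_natCast_atTop_atTop)
      have : ((s % d : ℕ) : ℝ) ≤ d := by exact_mod_cast (Nat.mod_lt s hd0).le
      gcongr
    have h := (hmod.mul_const ((A i j : ℝ) - W i j)).const_add (W i j : ℝ)
    rw [zero_mul, add_zero] at h
    refine h.congr' ?_
    filter_upwards [eventually_gt_atTop 0] with s hs
    have hs' : (0 : ℝ) < s := by exact_mod_cast hs
    have e : (s : ℝ) = d * ((s / d : ℕ) : ℝ) + ((s % d : ℕ) : ℝ) := by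
      exact_mod_cast (Nat.div_add_mod s d).symm
    rw [eq_div_iff hs'.ne']
    push_cast
    rw [hV]
    have e2 : ((s % d : ℕ) : ℝ) / s * s = ((s % d : ℕ) : ℝ) := by field_simp
    calc ((W i j : ℝ) + ((s % d : ℕ) : ℝ) / s * (A i j - W i j)) * s
        = W i j * s + ((s % d : ℕ) : ℝ) / s * s * (A i j - W i j) := by ring
      _ = W i j * (d * ((s / d : ℕ) : ℝ) + ((s % d : ℕ) : ℝ)) +
          ((s % d : ℕ) : ℝ) * (A i j - W i j) := by rw [e2, ← e]
      _ = _ := by ring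

/-! ### The maximum of the entropy -/

theorem entry_le_of_mem_polytope {m n : ℕ} {κ : ℕ∞} {R : Fin m → ℕ} {C : Fin n → ℕ}
    {Z : Matrix (Fin m) (Fin n) ℝ} (hZ : Z ∈ polytope κ R C) (i : Fin m) (j : Fin n) :
    Z i j ≤ R i := by
  rw [← hZ.2.2.1 i]
  exact Finset.single_le_sum (f := fun j => Z i j) (fun j _ => hZ.1 i j) (Finset.mem_univ j)

/-- Row sums bound the entries even when `κ = ⊤`. -/
theorem isCompact_polytope {m n : ℕ} (κ : ℕ∞) (R : Fin m → ℕ) (C : Fin n → ℕ) :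
    IsCompact (polytope κ R C) := by
  have hc : IsCompact (Set.pi Set.univ fun i : Fin m => Set.pi Set.univ fun _ : Fin n =>
      Set.Icc (0 : ℝ) (R i)) :=
    isCompact_univ_pi fun i => isCompact_univ_pi fun _ => isCompact_Icc
  refine IsCompact.of_isClosed_subset (X := Fin m → Fin n → ℝ) hc ?_
    fun Z hZ i _ j _ => ⟨hZ.1 i j, entry_le_of_mem_polytope hZ i j⟩
  have hij : ∀ i j, Continuous fun Z : Fin m → Fin n → ℝ => Z i j := fun i j => by fun_prop
  have h : polytope κ R C = {Z : Fin m → Fin n → ℝ | (∀ i j, 0 ≤ Z i j) ∧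
    (∀ k : ℕ, κ = k → ∀ i j, Z i j ≤ k) ∧
    (∀ i, ∑ j, Z i j = R i) ∧ (∀ j, ∑ i, Z i j = C j)} := rfl
  rw [h]
  simp only [Set.ofPred_and, Set.ofPred_forall]
  refine (isClosed_iInter fun i => isClosed_iInter fun j =>
    isClosed_le continuous_const (hij i j)).inter (IsClosed.inter ?_ (IsClosed.inter ?_ ?_))
  · exact isClosed_iInter fun k => isClosed_iInter fun _ => isClosed_iInter fun i =>
      isClosed_iInter fun j => isClosed_le (hij i j) continuous_const
  · exact isClosed_iInter fun i => isClosed_eq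
      (continuous_finsetSum _ fun j _ => hij i j) continuous_const
  · exact isClosed_iInter fun j => isClosed_eq
      (continuous_finsetSum _ fun i _ => hij i j) continuous_const

theorem continuousOn_sum_Hmax {m n : ℕ} (κ : ℕ∞) (R : Fin m → ℕ) (C : Fin n → ℕ) :
    ContinuousOn (fun Z : Matrix (Fin m) (Fin n) ℝ => ∑ i, ∑ j, Hmax κ (Z i j))
      (polytope κ R C) := by
  refine continuousOn_finsetSum _ fun i _ => continuousOn_finsetSum _ fun j _ => ?_
  exact (continuousOn_Hmax κ).comp (f := fun Z : Matrix (Fin m) (Fin n) ℝ => Z i j)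
    ((continuous_id (X := Matrix (Fin m) (Fin n) ℝ)).matrix_elem i j).continuousOn
    fun Z hZ => polytope_mem_meanRange hZ i j

theorem polytope_nonempty {m n : ℕ} {κ : ℕ∞} {R : Fin m → ℕ} {C : Fin n → ℕ}
    (hT : 0 < numTables κ R C) : (polytope κ R C).Nonempty := by
  obtain ⟨A, hA⟩ := Set.nonempty_of_ncard_ne_zero hT.ne'
  exact ⟨_, (mem_tables_iff κ R C A).1 hA⟩

/-! ### The number of cloned tables -/

/-- The logarithm of `nomial_pow_le`. Since `c ≤ s * r`, the factor `s * c + 1` is at most `s ^ 2 *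
(r + 1)`, so the loss is `O(s log s)`, negligible against `s ^ 2`. -/
theorem le_log_numTables_const {κ : ℕ∞} {s c r : ℕ} (hs : 0 < s)
    (hκ : ∀ k : ℕ, κ = k → c ≤ s * k) (hc : c ≤ s * r) :
    0 < numTables κ (fun _ : Fin s => c) (fun _ : Fin s => c) ∧
    (s : ℝ) * Real.log (nomial κ s c) - s * (2 * Real.log s + Real.log (r + 1)) ≤
      Real.log (numTables κ (fun _ : Fin s => c) (fun _ : Fin s => c)) := by
  have hs' : (0 : ℝ) < s := by exact_mod_cast hs
  have hν : 0 < nomial κ s c := nomial_pos_of_le (fun h => absurd h hs.ne') hκ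
  have h := nomial_pow_le κ s c
  have hT : 0 < numTables κ (fun _ : Fin s => c) (fun _ : Fin s => c) :=
    Nat.pos_of_ne_zero fun h0 => by
      rw [h0, zero_mul] at h
      exact (pow_pos hν s).ne' (Nat.le_zero.1 h)
  refine ⟨hT, ?_⟩
  have hν' : (0 : ℝ) < nomial κ s c := by exact_mod_cast hν
  have hT' : (0 : ℝ) < numTables κ (fun _ : Fin s => c) (fun _ : Fin s => c) := by
    exact_mod_cast hT
  have h1 : (nomial κ s c : ℝ) ^ s ≤
      numTables κ (fun _ : Fin s => c) (fun _ : Fin s => c) * ((s : ℝ) * c + 1) ^ s := by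
    exact_mod_cast h
  have h2 := Real.log_le_log (by positivity) h1
  rw [Real.log_pow, Real.log_mul hT'.ne' (by positivity), Real.log_pow] at h2
  have h3 : Real.log ((s : ℝ) * c + 1) ≤ 2 * Real.log s + Real.log (r + 1) := by
    have e : 2 * Real.log s + Real.log (r + 1) = Real.log ((s : ℝ) ^ 2 * (r + 1)) := by
      rw [Real.log_mul (by positivity) (by positivity), Real.log_pow]
      push_cast
      rfl
    rw [e]
    refine Real.log_le_log (by positivity) ?_
    have hc' : (c : ℝ) ≤ s * r := by exact_mod_cast hc
    have hs1 : (1 : ℝ) ≤ s := by exact_mod_cast hs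
    nlinarith
  have := mul_le_mul_of_nonneg_left h3 hs'.le
  linarith

/-- The asymptotic lower bound for the number of cloned tables at a rational point. -/
theorem exists_tendsto_le_log_numTables {m n : ℕ} {κ : ℕ∞} {R : Fin m → ℕ} {C : Fin n → ℕ}
    (hT : 0 < numTables κ R C) {W : Matrix (Fin m) (Fin n) ℚ}
    (hW : W.map (fun q : ℚ => (q : ℝ)) ∈ polytope κ R C) :
    ∃ L : ℕ → ℝ, Tendsto L atTop (𝓝 (∑ i, ∑ j, Hmax κ (W i j))) ∧
      ∀ s, 0 < s → 0 < numTables κ (clone s R) (clone s C) ∧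
        L s ≤ 1 / (s : ℝ) ^ 2 * Real.log (numTables κ (clone s R) (clone s C)) := by
  obtain ⟨K, hK, hKt⟩ := exists_tendsto_tables hT hW
  -- The sum of the block bounds divided by `s ^ 2`; `R i` serves as `r` because `K s i j` is at
  -- most the row sum `s * R i`.
  refine ⟨fun s => ∑ i, ∑ j, (Real.log (nomial κ s (K s i j)) / s -
    (2 * (Real.log s / s) + Real.log (R i + 1) / s)), ?_, fun s hs => ?_⟩
  · refine tendsto_finsetSum _ fun i _ => tendsto_finsetSum _ fun j _ => ?_
    have h1 := tendsto_log_nomial (polytope_mem_meanRange hW i j) tendsto_id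
      (Eventually.of_forall fun s k e => (hK s).1 k e i j) (hKt i j)
    have h2 : Tendsto (fun s : ℕ => Real.log s / s) atTop (𝓝 0) :=
      (Real.isLittleO_log_id_atTop.tendsto_div_nhds_zero).comp tendsto_natCast_atTop_atTop
    have h3 : Tendsto (fun s : ℕ => Real.log (R i + 1) / s) atTop (𝓝 0) :=
      tendsto_const_nhds.div_atTop tendsto_natCast_atTop_atTop
    have h4 := h1.sub ((h2.const_mul 2).add h3)
    simpa using h4
  · have hs' : (0 : ℝ) < s := by exact_mod_cast hs
    have hb : ∀ i j, _ := fun i j => le_log_numTables_const (κ := κ) (r := R i) hs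
      (fun k e => (hK s).1 k e i j) (by
        rw [← (hK s).2.1 i]
        exact Finset.single_le_sum (f := fun j => K s i j) (fun _ _ => Nat.zero_le _)
          (Finset.mem_univ j))
    have hle := prod_numTables_le κ (K s) (hK s).2.1 (hK s).2.2
    have hpos : 0 < ∏ p : Fin m × Fin n, numTables κ (fun _ : Fin s => K s p.1 p.2)
        (fun _ : Fin s => K s p.1 p.2) := Finset.prod_pos fun p _ => (hb p.1 p.2).1
    refine ⟨hpos.trans_le hle, ?_⟩
    have hle' : Real.log ((∏ p : Fin m × Fin n, numTables κ (fun _ : Fin s => K s p.1 p.2)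
        (fun _ : Fin s => K s p.1 p.2) : ℕ) : ℝ) ≤
          Real.log (numTables κ (clone s R) (clone s C)) :=
      Real.log_le_log (by exact_mod_cast hpos) (by exact_mod_cast hle)
    rw [Nat.cast_prod, Real.log_prod (fun p _ => by
      exact_mod_cast (hb p.1 p.2).1.ne'), Fintype.sum_prod_type] at hle'
    rw [one_div, inv_mul_eq_div, le_div_iff₀ (by positivity)]
    refine le_trans ?_ hle'
    rw [Finset.sum_mul]
    refine Finset.sum_le_sum fun i _ => ?_
    rw [Finset.sum_mul]
    refine Finset.sum_le_sum fun j _ => (le_of_eq ?_).trans (hb i j).2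
    field_simp

theorem tendsto_log_numTables {m n : ℕ} {κ : ℕ∞} {R : Fin m → ℕ} {C : Fin n → ℕ}
    (hT : 0 < numTables κ R C) :
    ∃ M : ℝ, IsGreatest ((fun Z : Matrix (Fin m) (Fin n) ℝ => ∑ i, ∑ j, Hmax κ (Z i j)) ''
        polytope κ R C) M ∧
      Tendsto (fun s : ℕ => 1 / (s : ℝ) ^ 2 *
        Real.log (numTables κ (clone s R) (clone s C) : ℝ)) atTop (𝓝 M) := by
  obtain ⟨Z, hZ, hmax⟩ := (isCompact_polytope κ R C).exists_isMaxOn (polytope_nonempty hT)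
    (continuousOn_sum_Hmax κ R C)
  have hM : ∀ Y ∈ polytope κ R C, ∑ i, ∑ j, Hmax κ (Y i j) ≤ ∑ i, ∑ j, Hmax κ (Z i j) := hmax
  refine ⟨∑ i, ∑ j, Hmax κ (Z i j), ⟨⟨Z, hZ, rfl⟩, ?_⟩, ?_⟩
  · rintro _ ⟨Y, hY, rfl⟩
    exact hM Y hY
  obtain ⟨W, hW, hWt⟩ := exists_tendsto_rat_polytope hZ
  have hWH : Tendsto (fun k => ∑ i, ∑ j, Hmax κ (W k i j)) atTop
      (𝓝 (∑ i, ∑ j, Hmax κ (Z i j))) := by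
    refine tendsto_finsetSum _ fun i _ => tendsto_finsetSum _ fun j _ => ?_
    exact (continuousOn_Hmax κ _ (polytope_mem_meanRange hZ i j)).tendsto.comp
      (tendsto_nhdsWithin_iff.2 ⟨hWt i j, hW.mono fun k hk => polytope_mem_meanRange hk i j⟩)
  have hpos : ∀ s, 0 < s → 0 < numTables κ (clone s R) (clone s C) := by
    obtain ⟨k, hk⟩ := hW.exists
    obtain ⟨L, -, hL⟩ := exists_tendsto_le_log_numTables hT hk
    exact fun s hs => (hL s hs).1
  rw [tendsto_order]
  refine ⟨fun a ha => ?_, fun a ha => ?_⟩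
  -- One rational point with entropy above `a` is fixed before `s` tends to infinity.
  · obtain ⟨k, hk, hk'⟩ := ((hWH.eventually (lt_mem_nhds ha)).and hW).exists
    obtain ⟨L, hLt, hL⟩ := exists_tendsto_le_log_numTables hT hk'
    filter_upwards [hLt.eventually (lt_mem_nhds hk), eventually_gt_atTop 0] with s h1 h2
    exact h1.trans_le (hL s h2).2
  · filter_upwards [eventually_gt_atTop 0] with s hs
    have hs' : (0 : ℝ) < s := by exact_mod_cast hs
    obtain ⟨Y, hY, h⟩ := exists_log_numTables_clone_le hs (hpos s hs)
    refine lt_of_le_of_lt ?_ ha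
    rw [one_div, inv_mul_eq_div, div_le_iff₀' (by positivity)]
    exact h.trans (mul_le_mul_of_nonneg_left (hM Y hY) (by positivity))

/-! ### The independence heuristic -/

/-- The ratio `k / a` stays fixed under scaling. The scale `t s` is `s` for the row and column
coefficients and `s ^ 2` for the grand total; for `a = 0` both sides are 0. -/
theorem tendsto_log_nomial_mul {κ : ℕ∞} {a k : ℕ} (ha : a = 0 → k = 0)
    (hk : ∀ K : ℕ, κ = K → k ≤ a * K) {t : ℕ → ℕ} (ht : Tendsto t atTop atTop) :
    Tendsto (fun s => Real.log (nomial κ (t s * a) (t s * k)) / t s) atTop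
      (𝓝 (a * Hmax κ (k / a))) := by
  rcases Nat.eq_zero_or_pos a with rfl | ha0
  · simp [ha rfl, nomial_zero_right]
  have ha' : (0 : ℝ) < a := by exact_mod_cast ha0
  have hx : (k / a : ℝ) ∈ meanRange κ := by
    refine ⟨by positivity, fun K e => ?_⟩
    rw [div_le_iff₀ ha']
    exact_mod_cast (hk K e).trans_eq (mul_comm _ _)
  have ht0 := ht.eventually_gt_atTop 0
  have h := tendsto_log_nomial hx (n := fun s => t s * a) (k := fun s => t s * k)
    (ht.atTop_mul_const' ha0) (Eventually.of_forall fun s K e => by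
      rw [mul_assoc]
      exact Nat.mul_le_mul_left _ (hk K e))
    (tendsto_const_nhds.congr' (by
      filter_upwards [ht0] with s hs
      have hs' : (0 : ℝ) < t s := by exact_mod_cast hs
      push_cast
      field_simp))
  refine (h.const_mul (a : ℝ)).congr' ?_
  filter_upwards [ht0] with s hs
  have hs' : (0 : ℝ) < t s := by exact_mod_cast hs
  push_cast
  field_simp

theorem sum_clone {m s : ℕ} (R : Fin m → ℕ) (f : ℕ → ℝ) :
    ∑ a, f (clone s R a) = s * ∑ i, f (s * R i) := by
  simp [sum_clone_index, clone, modNat_finProdFinEquiv, Finset.mul_sum]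

theorem tendsto_log_indepHeuristic {m n N : ℕ} {κ : ℕ∞} {R : Fin m → ℕ} {C : Fin n → ℕ}
    (hR : ∑ i, R i = N) (hC : ∑ j, C j = N) (hT : 0 < numTables κ R C) :
    Tendsto (fun s : ℕ => 1 / (s : ℝ) ^ 2 *
        Real.log (indepHeuristic κ (clone s R) (clone s C))) atTop
      (𝓝 (-((m : ℝ) * n * Hmax κ ((N : ℝ) / (m * n)))
        + n * ∑ i, Hmax κ ((R i : ℝ) / n)
        + m * ∑ j, Hmax κ ((C j : ℝ) / m))) := by
  -- A single table bounds all margins and the total, which keeps every nomial coefficient nonzero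
  -- and its ratio within the range of means.
  obtain ⟨A, hAκ, hAR, hAC⟩ := Set.nonempty_of_ncard_ne_zero hT.ne'
  have hA : ∀ K : ℕ, κ = K → ∀ i j, A i j ≤ K := fun K e i j => by
    have := hAκ i j
    rw [e] at this
    exact_mod_cast this
  have hRκ : ∀ i, ∀ K : ℕ, κ = K → R i ≤ n * K := fun i K e => by
    rw [← hAR i]
    exact (Finset.sum_le_sum fun j _ => hA K e i j).trans_eq (by simp)
  have hCκ : ∀ j, ∀ K : ℕ, κ = K → C j ≤ m * K := fun j K e => by
    rw [← hAC j]
    exact (Finset.sum_le_sum fun i _ => hA K e i j).trans_eq (by simp)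
  have hNκ : ∀ K : ℕ, κ = K → N ≤ m * n * K := fun K e => by
    rw [← hR]
    exact (Finset.sum_le_sum fun i _ => hRκ i K e).trans_eq (by simp [mul_assoc])
  have hR0 : ∀ i, n = 0 → R i = 0 := by
    rintro i rfl
    simp [← hAR i]
  have hC0 : ∀ j, m = 0 → C j = 0 := by
    rintro j rfl
    simp [← hAC j]
  have hN0 : m * n = 0 → N = 0 := fun h => by
    rcases Nat.mul_eq_zero.1 h with h | h
    · rw [← hC, Finset.sum_eq_zero fun j _ => hC0 j h]
    · rw [← hR, Finset.sum_eq_zero fun i _ => hR0 i h]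
  have t₁ := tendsto_log_nomial_mul (κ := κ) hN0 hNκ (t := fun s => s ^ 2)
    (tendsto_pow_atTop two_ne_zero)
  have t₂ := tendsto_finsetSum Finset.univ fun i _ =>
    tendsto_log_nomial_mul (κ := κ) (hR0 i) (hRκ i) (t := id) tendsto_id
  have t₃ := tendsto_finsetSum Finset.univ fun j _ =>
    tendsto_log_nomial_mul (κ := κ) (hC0 j) (hCκ j) (t := id) tendsto_id
  have key := (t₁.neg.add t₂).add t₃
  simp only [← Finset.mul_sum] at key
  push_cast at key
  refine key.congr' ?_
  filter_upwards [eventually_gt_atTop 0] with s hs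
  have hs' : (0 : ℝ) < s := by exact_mod_cast hs
  have mono : ∀ {a k : ℕ}, (∀ K : ℕ, κ = K → k ≤ a * K) → ∀ t : ℕ, ∀ K : ℕ, κ = K →
      t * k ≤ t * a * K := fun h t K e => by
    rw [mul_assoc]
    exact Nat.mul_le_mul_left _ (h K e)
  have zero : ∀ {a k : ℕ} (t : ℕ), 0 < t → (a = 0 → k = 0) → t * a = 0 → t * k = 0 :=
    fun t ht h h' => by rw [h ((Nat.mul_eq_zero.1 h').resolve_left ht.ne'), mul_zero]
  have p₁ : (nomial κ (s ^ 2 * (m * n)) (s ^ 2 * N) : ℝ) ≠ 0 := by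
    exact_mod_cast (nomial_pos_of_le (zero _ (by positivity) hN0) (mono hNκ _)).ne'
  have p₂ : ∀ a, (nomial κ (s * n) (clone s R a) : ℝ) ≠ 0 := fun a => by
    exact_mod_cast (nomial_pos_of_le (zero s hs (hR0 _)) (mono (hRκ _) s)).ne'
  have p₃ : ∀ b, (nomial κ (s * m) (clone s C b) : ℝ) ≠ 0 := fun b => by
    exact_mod_cast (nomial_pos_of_le (zero s hs (hC0 _)) (mono (hCκ _) s)).ne'
  have e₁ : s * m * (s * n) = s ^ 2 * (m * n) := by ring
  have e₂ : ∑ a, clone s R a = s ^ 2 * N := by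
    have := sum_clone (s := s) R fun x => (x : ℝ)
    rw [← hR]
    push_cast [← Finset.mul_sum] at this
    have h : ((∑ a, clone s R a : ℕ) : ℝ) = ((s ^ 2 * ∑ i, R i : ℕ) : ℝ) := by
      push_cast
      rw [this]
      ring
    exact_mod_cast h
  -- The logarithm becomes a sum of log-coefficients. The `s` equal copies of each row or column
  -- factor cancel one power of `s`, leaving scale `s` in those terms.
  rw [indepHeuristic, e₁, e₂,
    Real.log_mul (mul_ne_zero (inv_ne_zero p₁) (Finset.prod_ne_zero_iff.2 fun a _ => p₂ a))
      (Finset.prod_ne_zero_iff.2 fun b _ => p₃ b),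
    Real.log_mul (inv_ne_zero p₁) (Finset.prod_ne_zero_iff.2 fun a _ => p₂ a), Real.log_inv,
    Real.log_prod fun a _ => p₂ a, Real.log_prod fun b _ => p₃ b,
    sum_clone R fun x => Real.log (nomial κ (s * n) x),
    sum_clone C fun x => Real.log (nomial κ (s * m) x)]
  simp only [id, ← Finset.sum_div]
  field_simp

end CTable

theorem theorem3 (m n N : ℕ) (R : Fin m → ℕ) (C : Fin n → ℕ) (κ : ℕ∞) (hκ : 0 < κ)
    (hR : ∑ i, R i = N) (hC : ∑ j, C j = N) (hT : 0 < CTable.numTables κ R C) :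
    (∃ M : ℝ,
      IsGreatest ((fun Z : Matrix (Fin m) (Fin n) ℝ => ∑ i, ∑ j, CTable.Hmax κ (Z i j)) ''
        CTable.polytope κ R C) M ∧
      Tendsto (fun s : ℕ => 1 / (s : ℝ) ^ 2 *
        Real.log (CTable.numTables κ (CTable.clone s R) (CTable.clone s C) : ℝ)) atTop (𝓝 M)) ∧
    Tendsto (fun s : ℕ => 1 / (s : ℝ) ^ 2 *
        Real.log (CTable.indepHeuristic κ (CTable.clone s R) (CTable.clone s C))) atTop
      (𝓝 (-((m : ℝ) * n * CTable.Hmax κ ((N : ℝ) / (m * n)))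
        + n * ∑ i, CTable.Hmax κ ((R i : ℝ) / n)
        + m * ∑ j, CTable.Hmax κ ((C j : ℝ) / m))) :=
  ⟨CTable.tendsto_log_numTables hT, CTable.tendsto_log_indepHeuristic hR hC hT⟩
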